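/- **Setting.** Let $\Omega\subset\mathbb R^2$ be a bounded open set, $K>0$ a real number, $\beta\in L^\infty(\Omega)^2$ with $\operatorname{div}\beta=0$ in the sense of distributions, and $k\ge1$ an integer. Write $(\cdot,\cdot)_E$, $\|\cdot\|_E$ for the $L^2(E)$ scalar product and norm, and $\mathbb P_n(E)$ for the polynomials of degree at most $n$. *Meshes.* A mesh $\mathcal M_h$ of $\Omega$ is a finite family of pairwise disjoint open polygons $E\subset\Omega$ (each bounded by a simple closed polygonal chain, angles $\pi$ being allowed at vertices) whose closures cover $\Omega$; $h_E=\operatorname{diam}E$ and $h=\max_E h_E$. Each $E$ carries a point $(x_E,y_E)$. A polygon is $\kappa$-regular ($\kappa>0$) if it is star-shaped with respect to a ball centred at $(x_E,y_E)$ of radius $\rho\ge\kappa h_E$ and all its edges have length at least $\kappa h_E$; a mesh is $\kappa$-regular if all its polygons are. *Spaces.* For $v\in H^1(E)$ let $\Pi^{\nabla,E}_kv\in\mathbb P_k(E)$ be given by $(\nabla\Pi^{\nabla,E}_kv,\nabla p)_E=(\nabla v,\nabla p)_E$ for all $p\in\mathbb P_k(E)$ together with $\int_{\partial E}\Pi^{\nabla,E}_kv=\int_{\partial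 E}v$ if $k=1$ and $\int_E\Pi^{\nabla,E}_kv=\int_Ev$ if $k>1$. Fix $t\in\{\max(k-2,0),\,k-1\}$. For an integer $\ell_E\ge0$ let $V^E_{k,\ell_E}$ be the set of $v\in H^1(E)$ such that $\Delta v\in\mathbb P_{k+\ell_E}(E)$, the trace of $v$ on $\partial E$ is continuous and is a polynomial of degree at most $k$ on each edge, and $(v,m)_E=(\Pi^{\nabla,E}_kv,m)_E$ for all monomials $m=\big(\frac{x-x_E}{h_E}\big)^{a}\big(\frac{y-y_E}{h_E}\big)^{b}$ with $t\le a+b\le k+\ell_E$. Given $\ell=(\ell_E)_{E\in\mathcal M_h}$, put $V_{k,\ell}=\{v\in H^1_0(\Omega): v|_E\in V^E_{k,\ell_E}\ \forall E\in\mathcal M_h\}$. *Forms.* Let $\beta_E=\sup_{v\in L^2(E)^2}\|\beta\cdot v\|_E/\|v\|_E$. Let $\tilde C_k$ be the largest constant such that $\tilde C_kh_E^2\|\Delta p\|_E^2\le\|\nabla p\|_E^2$ for all $p\in\mathbb P_k(E)$ and all $\kappa$-regular polygons $E$ (used for $k>1$). Put $m_1=\tfrac13$, $m_k=2\tilde C_k$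 for $k>1$, $\mathrm{Pe}_E=m_k\beta_Eh_E/K$, $\tau_E=\frac{h_E}{2\beta_E}\min\{1,\mathrm{Pe}_E\}$ (if $\beta_E=0$ the value of $\tau_E$ is immaterial). With $\Pi^{0,E}_n$ the $L^2(E)$-projection onto polynomials of degree at most $n$ (scalar or vector valued), set $$a_{h,E}(w,v)=(K\Pi^{0,E}_{k+\ell_E-1}\nabla w,\Pi^{0,E}_{k+\ell_E-1}\nabla v)_E+\tau_E(\beta\cdot\Pi^{0,E}_{k+\ell_E-1}\nabla w,\beta\cdot\Pi^{0,E}_{k+\ell_E-1}\nabla v)_E,$$ $$b_{h,E}(w,v)=(\beta\cdot\Pi^{0,E}_{k-1}\nabla w,\Pi^{0,E}_{k-1}v)_E,\qquad d_{h,E}(w,v)=-\tau_E\big(K\operatorname{div}(\Pi^{0,E}_{k-1}\nabla w),\beta\cdot\Pi^{0,E}_{k+\ell_E-1}\nabla v\big)_E,$$ $B^{\rm SUPG}_{h,E}=a_{h,E}+b_{h,E}+d_{h,E}$ and $|||v|||^2=\sum_{E\in\mathcal M_h}a_{h,E}(v,v)$. **Theorem.** Let $\kappa>0$ and $\alpha>0$.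 There is a constant $C>0$, depending only on $\Omega,K,\beta,k,t,\kappa,\alpha$, such that for every $\kappa$-regular mesh $\mathcal M_h$ of $\Omega$ and every choice of integers $\ell_E\ge0$ with $$\|\Pi^{0,E}_{k+\ell_E-1}\nabla v\|_E^2\ge\alpha\|\nabla v\|_E^2\qquad\forall v\in V^E_{k,\ell_E},\ \forall E\in\mathcal M_h,$$ one has $$\sum_{E\in\mathcal M_h}B^{\rm SUPG}_{h,E}(v_h,v_h)\ \ge\ \Big(\frac12-Ch\Big)\,|||v_h|||^2\qquad\forall v_h\in V_{k,\ell}.$$ In particular the form is coercive for $h$ small enough: there are $h_0>0$ and $c>0$, depending only on the same data, such that for all such meshes with $h\le h_0$ and all such $\ell$, $\sum_EB^{\rm SUPG}_{h,E}(v_h,v_h)\ge c\,|||v_h|||^2$ for all $v_h\in V_{k,\ell}$. -/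

import Mathlib

open MeasureTheory Set Filter Topology
open scoped ContDiff

noncomputable section

namespace SUPGVEM

/-- The Euclidean plane. -/
abbrev Plane := EuclideanSpace ℝ (Fin 2)

/-- Lebesgue measure on a region `U` of the plane. -/
abbrev area (U : Set Plane) : Measure Plane := volume.restrict U

/-! ### Sobolev spaces -/

/-- `φ ∈ C_c^∞(U)`. -/
def IsTestFunction (U : Set Plane) (φ : Plane → ℝ) : Prop :=
  ContDiff ℝ ∞ φ ∧ HasCompactSupport φ ∧ tsupport φ ⊆ U

/-- `v ∈ H¹(U)` with weak gradient `G`. -/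
def HasWeakGrad (U : Set Plane) (v : Plane → ℝ) (G : Plane → Plane) : Prop :=
  MemLp v 2 (area U) ∧ MemLp G 2 (area U) ∧
    ∀ φ, IsTestFunction U φ → ∀ i : Fin 2,
      ∫ x in U, v x * gradient φ x i = -∫ x in U, G x i * φ x

/-- `v ∈ H¹(U)`. -/
def MemH1 (U : Set Plane) (v : Plane → ℝ) : Prop := ∃ G, HasWeakGrad U v G

open Classical in
/-- The weak gradient on `U` of a function in `H¹(U)` (unique almost everywhere on an open `U`). -/
def weakGrad (U : Set Plane) (v : Plane → ℝ) : Plane → Plane :=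
  if h : MemH1 U v then h.choose else 0

/-- `v ∈ H¹₀(U)`, the closure of `C_c^∞(U)` in `H¹(U)`. -/
def MemH10 (U : Set Plane) (v : Plane → ℝ) : Prop :=
  MemLp v 2 (area U) ∧ ∃ G : Plane → Plane, MemLp G 2 (area U) ∧
    ∃ φ : ℕ → Plane → ℝ, (∀ m, IsTestFunction U (φ m)) ∧
      Tendsto (fun m => eLpNorm (fun x => φ m x - v x) 2 (area U)) atTop (𝓝 0) ∧
      Tendsto (fun m => eLpNorm (fun x => gradient (φ m) x - G x) 2 (area U)) atTop (𝓝 0)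

/-- `Δ v = f` on `U` in the sense of distributions, for `v ∈ H¹(U)`. -/
def HasWeakLaplacian (U : Set Plane) (v f : Plane → ℝ) : Prop :=
  ∀ φ, IsTestFunction U φ →
    ∫ x in U, inner ℝ (weakGrad U v x) (gradient φ x) = -∫ x in U, f x * φ x

/-- `div β = 0` on `U` in the sense of distributions. -/
def IsDivergenceFree (U : Set Plane) (β : Plane → Plane) : Prop :=
  ∀ φ, IsTestFunction U φ → ∫ x in U, inner ℝ (β x) (gradient φ x) = 0

/-! ### Polynomials in two variables -/

/-- Bivariate real polynomials. -/
abbrev Poly := MvPolynomial (Fin 2) ℝ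

/-- The function on the plane given by a polynomial. -/
def polyFun (p : Poly) (x : Plane) : ℝ := MvPolynomial.eval (fun i => x i) p

/-- The vector field on the plane given by a pair of polynomials. -/
def polyField (P : Fin 2 → Poly) (x : Plane) : Plane := WithLp.toLp 2 fun i => polyFun (P i) x

/-- The gradient of a polynomial. -/
def polyGrad (p : Poly) : Fin 2 → Poly := fun i => MvPolynomial.pderiv i p

/-- The divergence of a polynomial vector field. -/
def polyDiv (P : Fin 2 → Poly) : Poly := ∑ i, MvPolynomial.pderiv i (P i)

/-- `p` is an `L²(U)`-projection of `w` onto the polynomials of degree at most `n`. -/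
def IsL2Proj (U : Set Plane) (n : ℕ) (w : Plane → ℝ) (p : Poly) : Prop :=
  p.totalDegree ≤ n ∧ ∀ q : Poly, q.totalDegree ≤ n →
    ∫ x in U, polyFun p x * polyFun q x = ∫ x in U, w x * polyFun q x

open Classical in
/-- The `L²(U)`-projection onto the polynomials of degree at most `n`
(which exists and is unique for `w ∈ L²(U)` and `U` bounded, open and nonempty). -/
def l2Proj (U : Set Plane) (n : ℕ) (w : Plane → ℝ) : Poly :=
  if h : ∃ p, IsL2Proj U n w p then h.choose else 0

/-- The `L²(U)²`-projection onto pairs of polynomials of degree at most `n`. -/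
def l2ProjField (U : Set Plane) (n : ℕ) (G : Plane → Plane) : Fin 2 → Poly :=
  fun i => l2Proj U n fun x => G x i

/-! ### Polygons and meshes -/

/-- A closed polygonal chain is simple: distinct edges meet at most in a common vertex. -/
def IsSimple {n : ℕ} (P : Polygon Plane n) : Prop :=
  Function.Injective P.vertices ∧
    ∀ i j, i ≠ j → ∀ x ∈ P.edgeSet ℝ i ∩ P.edgeSet ℝ j,
      (j = finRotate n i ∧ x = P j) ∨ (i = finRotate n j ∧ x = P i)

/-- An open polygonal element: the region enclosed by a simple closed polygonal chain, together
with a distinguished point (the center used for the scaled monomials). Angles of `π` are allowed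
at the vertices. -/
structure Element where
  /-- number of vertices -/
  n : ℕ
  three_le : 3 ≤ n
  /-- the boundary chain -/
  chain : Polygon Plane n
  simple : IsSimple chain
  /-- the open region -/
  carrier : Set Plane
  isOpen : IsOpen carrier
  isConnected : IsConnected carrier
  isBounded : Bornology.IsBounded carrier
  frontier_eq : frontier carrier = chain.boundary ℝ
  /-- the center -/
  center : Plane

namespace Element

/-- The diameter `h_E`. -/
def h (E : Element) : ℝ := Metric.diam E.carrier

/-- The length of the `i`-th edge. -/
def edgeLength (E : Element) (i : Fin E.n) : ℝ := dist (E.chain i) (E.chain (finRotate E.n i))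

/-- The integral of `f` over the boundary, with respect to arc length. -/
def boundaryIntegral (E : Element) (f : Plane → ℝ) : ℝ :=
  ∑ i, E.edgeLength i * ∫ s in (0 : ℝ)..1, f (E.chain.edgePath ℝ i s)

/-- Shape regularity: `E` is star-shaped with respect to a ball of radius at least `κ h_E` around
its center, and every edge has length at least `κ h_E`. -/
def IsRegular (E : Element) (κ : ℝ) : Prop :=
  (∃ ρ, κ * E.h ≤ ρ ∧ ∀ y ∈ Metric.ball E.center ρ, StarConvex ℝ y E.carrier) ∧
    ∀ i, κ * E.h ≤ E.edgeLength i

/-- `g` is the trace on `∂E` of `v ∈ H¹(E)`: some sequence of functions smooth up to the boundary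
tends to `v` in `H¹(E)` while its restrictions to `∂E` tend to `g` in `L²(∂E)`. -/
def IsTrace (E : Element) (v g : Plane → ℝ) : Prop :=
  ∃ φ : ℕ → Plane → ℝ, (∀ m, ContDiff ℝ ∞ (φ m)) ∧
    Tendsto (fun m => eLpNorm (fun x => φ m x - v x) 2 (area E.carrier)) atTop (𝓝 0) ∧
    Tendsto (fun m => eLpNorm (fun x => gradient (φ m) x - weakGrad E.carrier v x) 2
      (area E.carrier)) atTop (𝓝 0) ∧
    ∀ i, Tendsto (fun m => eLpNorm
      (fun s : ℝ => φ m (E.chain.edgePath ℝ i s) - g (E.chain.edgePath ℝ i s)) 2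
      (volume.restrict (Icc (0 : ℝ) 1))) atTop (𝓝 0)

/-- `p = Π^{∇,E}_k v`, where `g` is the trace of `v` on `∂E`. -/
def IsEllipticProj (E : Element) (k : ℕ) (v g : Plane → ℝ) (p : Poly) : Prop :=
  p.totalDegree ≤ k ∧
    (∀ q : Poly, q.totalDegree ≤ k →
      ∫ x in E.carrier, inner ℝ (polyField (polyGrad p) x) (polyField (polyGrad q) x) =
        ∫ x in E.carrier, inner ℝ (weakGrad E.carrier v x) (polyField (polyGrad q) x)) ∧
    (k = 1 → E.boundaryIntegral (polyFun p) = E.boundaryIntegral g) ∧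
    (1 < k → ∫ x in E.carrier, polyFun p x = ∫ x in E.carrier, v x)

/-- The scaled monomial `m_{(a,b)}`. -/
def scaledMonomial (E : Element) (a b : ℕ) (x : Plane) : ℝ :=
  ((x 0 - E.center 0) / E.h) ^ a * ((x 1 - E.center 1) / E.h) ^ b

/-- The local enlarged enhancement virtual element space of order `k` and enlargement degree `ℓ`.
The enhancement condition is imposed on the scaled monomials of degree from `t` to `k + ℓ`. -/
def MemLocalVEM (E : Element) (k ℓ t : ℕ) (v : Plane → ℝ) : Prop :=
  MemH1 E.carrier v ∧
  (∃ q : Poly, q.totalDegree ≤ k + ℓ ∧ HasWeakLaplacian E.carrier v (polyFun q)) ∧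
  ∃ g : Plane → ℝ, E.IsTrace v g ∧ ContinuousOn g (frontier E.carrier) ∧
    (∀ i, ∃ p : Polynomial ℝ, p.natDegree ≤ k ∧
      ∀ s ∈ Icc (0 : ℝ) 1, g (E.chain.edgePath ℝ i s) = p.eval s) ∧
    ∃ p : Poly, E.IsEllipticProj k v g p ∧
      ∀ a b : ℕ, t ≤ a + b → a + b ≤ k + ℓ →
        ∫ x in E.carrier, v x * E.scaledMonomial a b x =
          ∫ x in E.carrier, polyFun p x * E.scaledMonomial a b x

/-- The projected gradient controls the full gradient on the local space:
`‖Π⁰_{k+ℓ-1} ∇v‖²_E ≥ α ‖∇v‖²_E`. -/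
def GradientCoercive (E : Element) (k ℓ t : ℕ) (α : ℝ) : Prop :=
  ∀ v, E.MemLocalVEM k ℓ t v →
    α * lpNorm (weakGrad E.carrier v) 2 (area E.carrier) ^ 2 ≤
      lpNorm (polyField (l2ProjField E.carrier (k + ℓ - 1) (weakGrad E.carrier v))) 2
        (area E.carrier) ^ 2

end Element

/-- A finite mesh of `Ω` made of polygons. -/
structure Mesh (Ω : Set Plane) where
  /-- number of elements -/
  N : ℕ
  /-- the elements -/
  elt : Fin N → Element
  subset : ∀ i, (elt i).carrier ⊆ Ω
  disjoint : ∀ i j, i ≠ j → Disjoint (elt i).carrier (elt j).carrier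
  cover : Ω ⊆ ⋃ i, closure (elt i).carrier

namespace Mesh

variable {Ω : Set Plane}

/-- The mesh size `h`, the maximum of the diameters. -/
def h (M : Mesh Ω) : ℝ := ⨆ i, (M.elt i).h

/-- The global virtual element space. -/
def MemVEM (M : Mesh Ω) (k : ℕ) (ℓ : Fin M.N → ℕ) (t : ℕ) (v : Plane → ℝ) : Prop :=
  MemH10 Ω v ∧ ∀ i, (M.elt i).MemLocalVEM k (ℓ i) t v

end Mesh

/-! ### The SUPG parameter -/

/-- `β_U = sup_v ‖β · v‖_U / ‖v‖_U`. -/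
def betaNorm (β : Plane → Plane) (U : Set Plane) : ℝ :=
  sSup {r | ∃ v : Plane → Plane, MemLp v 2 (area U) ∧ lpNorm v 2 (area U) ≠ 0 ∧
    r = lpNorm (fun x => inner ℝ (β x) (v x)) 2 (area U) / lpNorm v 2 (area U)}

/-- `C̃_k`: the largest constant with `C̃_k h_E² ‖Δp‖²_E ≤ ‖∇p‖²_E` for all polynomials `p` of degree
at most `k` and all elements `E` of regularity `κ`. -/
def inverseConst (k : ℕ) (κ : ℝ) : ℝ :=
  sSup {c | ∀ E : Element, E.IsRegular κ → ∀ p : Poly, p.totalDegree ≤ k →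
    c * E.h ^ 2 * lpNorm (polyFun (polyDiv (polyGrad p))) 2 (area E.carrier) ^ 2 ≤
      lpNorm (polyField (polyGrad p)) 2 (area E.carrier) ^ 2}

/-- The constant `m_k`. -/
def mConst (k : ℕ) (κ : ℝ) : ℝ := if k = 1 then 1 / 3 else 2 * inverseConst k κ

/-- The element Péclet number. -/
def peclet (k : ℕ) (κ K : ℝ) (β : Plane → Plane) (E : Element) : ℝ :=
  mConst k κ * (betaNorm β E.carrier * E.h / K)

/-- The SUPG parameter `τ_E`. Where `β_E = 0` its value is immaterial, since `τ_E` only occurs in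
front of terms with a factor `β`. -/
def tau (k : ℕ) (κ K : ℝ) (β : Plane → Plane) (E : Element) : ℝ :=
  E.h / (2 * betaNorm β E.carrier) * min 1 (peclet k κ K β E)

/-! ### The discrete bilinear forms -/

/-- `Π⁰_n ∇v` on the element `E`. -/
def projGrad (E : Element) (n : ℕ) (v : Plane → ℝ) : Fin 2 → Poly :=
  l2ProjField E.carrier n (weakGrad E.carrier v)

/-- The form `a_{h,E}`. -/
def aForm (k : ℕ) (κ K : ℝ) (β : Plane → Plane) (E : Element) (ℓ : ℕ) (w v : Plane → ℝ) : ℝ :=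
  (∫ x in E.carrier, inner ℝ (K • polyField (projGrad E (k + ℓ - 1) w) x)
    (polyField (projGrad E (k + ℓ - 1) v) x)) +
  tau k κ K β E * ∫ x in E.carrier, inner ℝ (β x) (polyField (projGrad E (k + ℓ - 1) w) x) *
    inner ℝ (β x) (polyField (projGrad E (k + ℓ - 1) v) x)

/-- The form `b_{h,E}`. -/
def bForm (k : ℕ) (β : Plane → Plane) (E : Element) (w v : Plane → ℝ) : ℝ :=
  ∫ x in E.carrier, inner ℝ (β x) (polyField (projGrad E (k - 1) w) x) *
    polyFun (l2Proj E.carrier (k - 1) v) x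

/-- The form `d_{h,E}`. -/
def dForm (k : ℕ) (κ K : ℝ) (β : Plane → Plane) (E : Element) (ℓ : ℕ) (w v : Plane → ℝ) : ℝ :=
  -(tau k κ K β E * ∫ x in E.carrier, K * polyFun (polyDiv (projGrad E (k - 1) w)) x *
    inner ℝ (β x) (polyField (projGrad E (k + ℓ - 1) v) x))

/-- The local discrete SUPG form `B^{SUPG}_{h,E}`. -/
def supgForm (k : ℕ) (κ K : ℝ) (β : Plane → Plane) (E : Element) (ℓ : ℕ) (w v : Plane → ℝ) : ℝ :=
  aForm k κ K β E ℓ w v + bForm k β E w v + dForm k κ K β E ℓ w v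

/-- The VEM-SUPG norm `|||v|||`. -/
def energyNorm {Ω : Set Plane} (k : ℕ) (κ K : ℝ) (β : Plane → Plane) (M : Mesh Ω)
    (ℓ : Fin M.N → ℕ) (v : Plane → ℝ) : ℝ :=
  Real.sqrt (∑ i, aForm k κ K β (M.elt i) (ℓ i) v v)

end SUPGVEM

end

/-! With the same function in both slots, `aForm` sums to the squared energy norm, so only the
negative parts of `bForm` and `dForm` must be controlled. The hypothesis `GradientCoercive` bounds
the energy below by `α K ‖∇v‖²` (`ApproxH1.le_aForm_self`), so it is enough to measure both against
`‖∇v‖²` over `Ω`.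

The term `dForm` is `O(h)`: `τ_E` is at most of order `h²` (`tau_le`), while the divergence of a
polynomial field costs one power of `h` (`exists_inverse_ineq`).

For `bForm`, the exact convective form `∫ v β·∇v` vanishes on `Ω` because `div β = 0` and `v ∈ H¹₀`
(`integral_inner_smul_eq_zero_of_divergenceFree`). What remains is the consistency error. If `β`
were Lipschitz, freezing it at the element centre would make the error `O(h)`: a constant vector
times a polynomial of degree `k - 1` is orthogonal to `Π⁰∇v - ∇v`, and the other differences are
small by Poincaré or by the Lipschitz bound. But `β` is only bounded and has no modulus of
continuity in `L^∞`. It is therefore replaced by a Lipschitz field `g` close to it in `L⁴`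
(`exists_lipschitz_approx`). Since `H¹₀(Ω)` embeds in `L⁴`, the term with `v (β - g)` is at most a
small multiple of `‖∇v‖²` independent of the mesh (`exists_sobolev_const`). The closeness is chosen
so that this part consumes at most half of the energy, which gives the `1/2`; everything else is
`O(h)`, with a constant depending on `g` but not on the mesh (`exists_coercivity_const`). -/

namespace SUPGVEM

/-! ### Square-integrable functions: norms, Young's inequality, limits, Pythagoras. -/

section SquareIntegrable

variable {X F : Type*} [MeasurableSpace X] {μ : Measure X} [NormedAddCommGroup F]

theorem integrable_normSq {f : X → F} (hf : MemLp f 2 μ) : Integrable (fun x => ‖f x‖ ^ 2) μ :=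
  (memLp_two_iff_integrable_sq_norm hf.1).1 hf

theorem eLpNorm_two_sq {f : X → F} (hf : MemLp f 2 μ) :
    eLpNorm f 2 μ ^ 2 = ENNReal.ofReal (∫ x, ‖f x‖ ^ 2 ∂μ) := by
  rw [hf.eLpNorm_eq_integral_rpow_norm (by norm_num) (by norm_num),
    ← ENNReal.ofReal_pow (by positivity)]
  congr 1
  simp only [ENNReal.toReal_ofNat, Real.rpow_ofNat]
  rw [← Real.rpow_natCast, ← Real.rpow_mul (by positivity)]
  norm_num

theorem lpNorm_two_sq {f : X → F} (hf : MemLp f 2 μ) :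
    lpNorm f 2 μ ^ 2 = ∫ x, ‖f x‖ ^ 2 ∂μ := by
  rw [← toReal_eLpNorm hf.1, ← ENNReal.toReal_pow, eLpNorm_two_sq hf,
    ENNReal.toReal_ofReal (by positivity)]

/-- Dictionary between `eLpNorm`, in which limits of approximations are taken, and squared real
integrals, in which the estimates are added up. -/
theorem eLpNorm_two_le_iff {F' : Type*} [NormedAddCommGroup F'] {f : X → F} {g : X → F'}
    (hf : MemLp f 2 μ) (hg : MemLp g 2 μ) {c : ℝ} (hc : 0 ≤ c) :
    eLpNorm f 2 μ ≤ ENNReal.ofReal c * eLpNorm g 2 μ ↔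
      ∫ x, ‖f x‖ ^ 2 ∂μ ≤ c ^ 2 * ∫ x, ‖g x‖ ^ 2 ∂μ := by
  rw [← ENNReal.pow_le_pow_left_iff (two_ne_zero), mul_pow, eLpNorm_two_sq hf, eLpNorm_two_sq hg,
    ← ENNReal.ofReal_pow hc, ← ENNReal.ofReal_mul (by positivity),
    ENNReal.ofReal_le_ofReal_iff (by positivity)]

theorem memLp_two_of_bounded {f : X → F} [IsFiniteMeasure μ] (hf : AEStronglyMeasurable f μ)
    {B : ℝ} (hB : ∀ᵐ x ∂μ, ‖f x‖ ≤ B) : MemLp f 2 μ :=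
  (memLp_top_of_bound hf B hB).mono_exponent le_top

variable [InnerProductSpace ℝ F]

theorem integrable_inner {f g : X → F} (hf : MemLp f 2 μ) (hg : MemLp g 2 μ) :
    Integrable (fun x => inner ℝ (f x) (g x)) μ := by
  refine (((integrable_normSq hf).add (integrable_normSq hg))).mono' (hf.1.inner hg.1)
    (.of_forall fun x => ?_)
  have := abs_real_inner_le_norm (f x) (g x)
  rw [Real.norm_eq_abs, Pi.add_apply]
  nlinarith [sq_nonneg (‖f x‖ - ‖g x‖), sq_nonneg (‖f x‖), sq_nonneg (‖g x‖)]

/-- Young's inequality, from `0 ≤ s⁻¹ (s‖f‖ - ‖g‖)²` pointwise. The free weight `s` later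
distributes powers of `h` between the two factors. -/
theorem abs_integral_inner_le {f g : X → F} (hf : MemLp f 2 μ) (hg : MemLp g 2 μ) {s : ℝ}
    (hs : 0 < s) :
    |∫ x, inner ℝ (f x) (g x) ∂μ| ≤
      (s * ∫ x, ‖f x‖ ^ 2 ∂μ + s⁻¹ * ∫ x, ‖g x‖ ^ 2 ∂μ) / 2 := by
  rw [← integral_const_mul, ← integral_const_mul, ← integral_add
    ((integrable_normSq hf).const_mul _) ((integrable_normSq hg).const_mul _), ← integral_div]
  refine (abs_integral_le_integral_abs).trans (integral_mono_of_nonneg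
    (.of_forall fun x => abs_nonneg _)
    ((((integrable_normSq hf).const_mul _).add ((integrable_normSq hg).const_mul _)).div_const _)
    (.of_forall fun x => ?_))
  have := abs_real_inner_le_norm (f x) (g x)
  have h1 : 0 ≤ s⁻¹ * (s * ‖f x‖ - ‖g x‖) ^ 2 := by positivity
  have h2 : s⁻¹ * (s * ‖f x‖ - ‖g x‖) ^ 2 =
    s * ‖f x‖ ^ 2 + s⁻¹ * ‖g x‖ ^ 2 - 2 * (‖f x‖ * ‖g x‖) := by
    field_simp; ring
  linarith

theorem tendsto_integral_inner {f g : ℕ → X → F} {f' g' : X → F} (hf : ∀ m, MemLp (f m) 2 μ)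
    (hg : ∀ m, MemLp (g m) 2 μ) (hf' : MemLp f' 2 μ) (hg' : MemLp g' 2 μ)
    (h1 : Tendsto (fun m => eLpNorm (fun x => f m x - f' x) 2 μ) atTop (𝓝 0))
    (h2 : Tendsto (fun m => eLpNorm (fun x => g m x - g' x) 2 μ) atTop (𝓝 0)) :
    Tendsto (fun m => ∫ x, inner ℝ (f m x) (g m x) ∂μ) atTop
      (𝓝 (∫ x, inner ℝ (f' x) (g' x) ∂μ)) := by
  have key : ∀ {a b : X → F} (ha : MemLp a 2 μ) (hb : MemLp b 2 μ),
      ∫ x, inner ℝ (a x) (b x) ∂μ = inner ℝ (ha.toLp a) (hb.toLp b) := fun ha hb => by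
    rw [L2.inner_def]
    refine integral_congr_ae ?_
    filter_upwards [ha.coeFn_toLp, hb.coeFn_toLp] with x h1 h2
    rw [h1, h2]
  simp_rw [fun m => key (hf m) (hg m)]
  rw [key hf' hg']
  exact ((Lp.tendsto_Lp_iff_tendsto_eLpNorm'' f hf f' hf').2 h1).inner
    ((Lp.tendsto_Lp_iff_tendsto_eLpNorm'' g hg g' hg').2 h2)

/-- Pythagoras' theorem for a projection. -/
theorem integral_normSq_sub_add {f p q : X → F} (hf : MemLp f 2 μ) (hp : MemLp p 2 μ)
    (hq : MemLp q 2 μ) (h : ∫ x, inner ℝ (f x - p x) (p x - q x) ∂μ = 0) :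
    ∫ x, ‖f x - q x‖ ^ 2 ∂μ = ∫ x, ‖f x - p x‖ ^ 2 ∂μ + ∫ x, ‖p x - q x‖ ^ 2 ∂μ := by
  have h1 := integrable_normSq (hf.sub hp)
  have h2 := integrable_normSq (hp.sub hq)
  have h3 := integrable_inner (hf.sub hp) (hp.sub hq)
  simp only [Pi.sub_apply] at h1 h2 h3
  have e : ∀ x, ‖f x - q x‖ ^ 2 =
      ‖f x - p x‖ ^ 2 + 2 * inner ℝ (f x - p x) (p x - q x) + ‖p x - q x‖ ^ 2 := fun x => by
    rw [← norm_add_sq_real]; simp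
  simp_rw [e]
  have e1 := integral_add (h1.add (h3.const_mul 2)) h2
  have e2 := integral_add h1 (h3.const_mul 2)
  simp only [Pi.add_apply] at e1 e2
  rw [e1, e2, integral_const_mul, h]
  ring

end SquareIntegrable

/-! ### The space `H¹₀` -/

section Sobolev

theorem isFiniteMeasure_area {U : Set Plane} (hU : Bornology.IsBounded U) :
    IsFiniteMeasure (area U) :=
  ⟨by simpa using hU.measure_lt_top⟩

theorem continuous_gradient {φ : Plane → ℝ} (hφ : ContDiff ℝ ∞ φ) : Continuous (gradient φ) :=
  (LinearIsometryEquiv.continuous _).comp (hφ.continuous_fderiv (by simp))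

theorem gradient_apply (φ : Plane → ℝ) (x : Plane) (i : Fin 2) :
    gradient φ x i = fderiv ℝ φ x (EuclideanSpace.single i 1) := by
  rw [← toDual_gradient, InnerProductSpace.toDual_apply_apply, EuclideanSpace.inner_single_right]
  simp

theorem norm_gradient (φ : Plane → ℝ) (x : Plane) : ‖gradient φ x‖ = ‖fderiv ℝ φ x‖ := by
  rw [← toDual_gradient, LinearIsometryEquiv.norm_map]

theorem IsTestFunction.hasCompactSupport_gradient {U : Set Plane} {φ : Plane → ℝ}
    (h : IsTestFunction U φ) : HasCompactSupport (gradient φ) :=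
  (h.2.1.fderiv ℝ).comp_left (g := (InnerProductSpace.toDual ℝ Plane).symm) (map_zero _)

theorem memLp_of_continuous {F : Type*} [NormedAddCommGroup F] {U : Set Plane}
    (hU : Bornology.IsBounded U) {f : Plane → F}
    (hf : Continuous f) : MemLp f 2 (area U) := by
  have := isFiniteMeasure_area hU
  obtain ⟨C, hC⟩ := (hU.isCompact_closure).exists_bound_of_continuousOn hf.continuousOn
  refine memLp_two_of_bounded hf.aestronglyMeasurable (B := C) ?_
  exact ae_mono (Measure.restrict_mono subset_closure le_rfl)
    ((ae_restrict_mem isClosed_closure.measurableSet).mono fun x hx => hC x hx)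

theorem IsTestFunction.eq_zero_of_notMem {U : Set Plane} {ψ : Plane → ℝ}
    (h : IsTestFunction U ψ) {x : Plane} (hx : x ∉ U) : ψ x = 0 ∧ gradient ψ x = 0 := by
  have hx' : x ∉ tsupport ψ := fun h' => hx (h.2.2 h')
  refine ⟨image_eq_zero_of_notMem_tsupport hx', ?_⟩
  have : fderiv ℝ ψ x = 0 := by
    by_contra h'
    exact hx' (support_fderiv_subset ℝ h')
  rw [gradient, this, map_zero]

theorem integral_mul_gradient_eq_neg {U : Set Plane} {φ ψ : Plane → ℝ} (hφ : ContDiff ℝ ∞ φ)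
    (hψ : IsTestFunction U ψ) (i : Fin 2) :
    ∫ x in U, φ x * gradient ψ x i = -∫ x in U, gradient φ x i * ψ x := by
  have c1 := hφ.continuous
  have c2 : Continuous fun x => gradient φ x i :=
    (PiLp.continuous_apply 2 _ i).comp (continuous_gradient hφ)
  have c3 := hψ.1.continuous
  have c4 : Continuous fun x => gradient ψ x i :=
    (PiLp.continuous_apply 2 _ i).comp (continuous_gradient hψ.1)
  have s4 : HasCompactSupport fun x => gradient ψ x i :=
    hψ.hasCompactSupport_gradient.comp_left (g := fun y : Plane => y i) rfl
  rw [setIntegral_eq_integral_of_forall_compl_eq_zero fun x hx => by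
      rw [(hψ.eq_zero_of_notMem hx).2]; simp,
    setIntegral_eq_integral_of_forall_compl_eq_zero fun x hx => by
      rw [(hψ.eq_zero_of_notMem hx).1]; simp]
  simp_rw [gradient_apply] at c2 c4 s4 ⊢
  exact integral_mul_fderiv_eq_neg_fderiv_mul_of_integrable
    ((c2.mul c3).integrable_of_hasCompactSupport hψ.2.1.mul_left)
    ((c1.mul c4).integrable_of_hasCompactSupport s4.mul_left)
    ((c1.mul c3).integrable_of_hasCompactSupport hψ.2.1.mul_left)
    (fun x _ => (hφ.differentiable (by simp)) x) fun x _ => (hψ.1.differentiable (by simp)) x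

/-- `φ m → v` in `H¹(U)`, with `∇ φ m → G`. -/
structure ApproxH1 (U : Set Plane) (φ : ℕ → Plane → ℝ) (v : Plane → ℝ) (G : Plane → Plane) :
    Prop where
  contDiff : ∀ m, ContDiff ℝ ∞ (φ m)
  memLp : MemLp v 2 (area U)
  memLp_grad : MemLp G 2 (area U)
  tendsto : Tendsto (fun m => eLpNorm (fun x => φ m x - v x) 2 (area U)) atTop (𝓝 0)
  tendsto_grad : Tendsto (fun m => eLpNorm (fun x => gradient (φ m) x - G x) 2 (area U)) atTop (𝓝 0)

/-- Lets a single sequence on `Ω`, and hence a single gradient `G`, serve all elements of a mesh at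
once. -/
theorem ApproxH1.mono {U V : Set Plane} {φ : ℕ → Plane → ℝ} {v : Plane → ℝ} {G : Plane → Plane}
    (h : ApproxH1 U φ v G) (hV : V ⊆ U) : ApproxH1 V φ v G where
  contDiff := h.contDiff
  memLp := h.memLp.mono_measure (Measure.restrict_mono hV le_rfl)
  memLp_grad := h.memLp_grad.mono_measure (Measure.restrict_mono hV le_rfl)
  tendsto := tendsto_of_tendsto_of_tendsto_of_le_of_le tendsto_const_nhds h.tendsto
    (fun _ => zero_le) fun _ => eLpNorm_mono_measure _ (Measure.restrict_mono hV le_rfl)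
  tendsto_grad := tendsto_of_tendsto_of_tendsto_of_le_of_le tendsto_const_nhds h.tendsto_grad
    (fun _ => zero_le) fun _ => eLpNorm_mono_measure _ (Measure.restrict_mono hV le_rfl)

theorem ApproxH1.hasWeakGrad {U : Set Plane} (hU : Bornology.IsBounded U) {φ : ℕ → Plane → ℝ}
    {v : Plane → ℝ} {G : Plane → Plane} (h : ApproxH1 U φ v G) : HasWeakGrad U v G := by
  refine ⟨h.memLp, h.memLp_grad, fun ψ hψ i => ?_⟩
  have gψ : Continuous fun x => gradient ψ x i :=
    (PiLp.continuous_apply 2 _ i).comp (continuous_gradient hψ.1)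
  have t1 := tendsto_integral_inner (fun m => memLp_of_continuous hU (h.contDiff m).continuous)
    (fun _ => memLp_of_continuous hU gψ) h.memLp (memLp_of_continuous hU gψ) h.tendsto (by simp)
  have hc : Continuous fun x => ψ x • (EuclideanSpace.single i 1 : Plane) :=
    hψ.1.continuous.smul continuous_const
  have t2 := (tendsto_integral_inner (fun m => memLp_of_continuous hU
      (continuous_gradient (h.contDiff m))) (fun _ => memLp_of_continuous hU hc)
      h.memLp_grad (memLp_of_continuous hU hc) h.tendsto_grad (by simp)).neg
  simp only [inner_smul_right, EuclideanSpace.inner_single_right, one_mul,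
    conj_trivial, RCLike.inner_apply] at t1 t2
  have e : ∀ m, ∫ x in U, gradient ψ x i * φ m x = -∫ x in U, ψ x * gradient (φ m) x i := by
    intro m
    simpa only [mul_comm] using integral_mul_gradient_eq_neg (h.contDiff m) hψ i
  simp_rw [e] at t1
  simpa only [mul_comm] using tendsto_nhds_unique t1 t2

/-- The fundamental lemma of the calculus of variations, componentwise. It is what identifies the
arbitrarily chosen `weakGrad` with the limit of smooth gradients. -/
theorem HasWeakGrad.ae_eq {U : Set Plane} (hU : IsOpen U) {v : Plane → ℝ} {G G' : Plane → Plane}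
    (h : HasWeakGrad U v G) (h' : HasWeakGrad U v G') : G =ᵐ[area U] G' := by
  have key : ∀ i, ∀ᵐ x ∂(area U), G x i - G' x i = 0 := fun i => by
    have m1 : MemLp (fun x => G x i) 2 (area U) := h.2.1.eval_piLp i
    have m2 : MemLp (fun x => G' x i) 2 (area U) := h'.2.1.eval_piLp i
    have hl : LocallyIntegrableOn (fun x => G x i - G' x i) U :=
      locallyIntegrableOn_of_locallyIntegrable_restrict ((m1.sub m2).locallyIntegrable (by norm_num))
    rw [ae_restrict_iff' hU.measurableSet]
    refine hU.ae_eq_zero_of_integral_contDiff_smul_eq_zero hl fun ψ h1 h2 h3 => ?_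
    have hψ : IsTestFunction U ψ := ⟨h1, h2, h3⟩
    have mψ : MemLp ψ 2 (area U) :=
      (h1.continuous.memLp_of_hasCompactSupport h2).mono_measure Measure.restrict_le_self
    have e1 := h.2.2 ψ hψ i
    have e2 := h'.2.2 ψ hψ i
    rw [← setIntegral_eq_integral_of_forall_compl_eq_zero (s := U) fun x hx => by
      rw [(hψ.eq_zero_of_notMem hx).1]; simp]
    simp only [smul_eq_mul, mul_sub]
    have e3 := integral_sub (mψ.integrable_mul m1) (mψ.integrable_mul m2)
    simp only [Pi.mul_apply] at e3
    rw [e3]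
    simp_rw [mul_comm (ψ _)]
    linarith
  filter_upwards [key 0, key 1] with x h0 h1
  ext i
  fin_cases i
  · exact sub_eq_zero.1 h0
  · exact sub_eq_zero.1 h1

theorem HasWeakGrad.weakGrad_ae_eq {U : Set Plane} (hU : IsOpen U) {v : Plane → ℝ}
    {G : Plane → Plane} (h : HasWeakGrad U v G) : weakGrad U v =ᵐ[area U] G := by
  have h1 : MemH1 U v := ⟨G, h⟩
  have : HasWeakGrad U v (weakGrad U v) := by
    rw [weakGrad, dif_pos h1]
    exact h1.choose_spec
  exact this.ae_eq hU h

end Sobolev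

/-! ### Global facts on `Ω`: skew-symmetry of convection, Sobolev and Poincaré inequalities. -/

section Domain

variable {Ω : Set Plane} {φ : ℕ → Plane → ℝ} {v : Plane → ℝ} {G : Plane → Plane}

theorem MemH10.exists_approx (hv : MemH10 Ω v) :
    ∃ G φ, (∀ m, IsTestFunction Ω (φ m)) ∧ ApproxH1 Ω φ v G := by
  obtain ⟨h1, G, h2, φ, h3, h4, h5⟩ := hv
  exact ⟨G, φ, h3, fun m => (h3 m).1, h1, h2, h4, h5⟩

theorem gradient_sq {φ : Plane → ℝ} (hφ : ContDiff ℝ ∞ φ) (x : Plane) :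
    gradient (fun x => φ x ^ 2) x = (2 * φ x) • gradient φ x := by
  have hd : DifferentiableAt ℝ φ x := hφ.differentiable (by simp) x
  ext i
  rw [gradient_apply, PiLp.smul_apply, gradient_apply, fderiv_fun_pow 2 hd]
  simp

theorem memLp_smul_of_bounded {X F : Type*} [MeasurableSpace X] {μ : Measure X}
    [NormedAddCommGroup F] [NormedSpace ℝ F] {u : X → ℝ} {r : X → F} (hu : MemLp u 2 μ)
    (hr : MemLp r ⊤ μ) : MemLp (fun x => u x • r x) 2 μ :=
  hr.smul (r := 2) hu

theorem eLpNorm_smul_le_of_memLp_top {X F : Type*} [MeasurableSpace X] {μ : Measure X}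
    [NormedAddCommGroup F] [NormedSpace ℝ F] {u : X → ℝ} {r : X → F} (hu : MemLp u 2 μ)
    (hr : MemLp r ⊤ μ) :
    eLpNorm (fun x => u x • r x) 2 μ ≤ eLpNorm u 2 μ * eLpNorm r ⊤ μ :=
  eLpNorm_smul_le_mul_eLpNorm hr.1 hu.1

/-- For a test function, `φ ∇φ = ½ ∇(φ²)` and `φ²` is again a test function, so the integral is zero
by `div β = 0`. Boundedness of `β` carries this to the `H¹` limit. -/
theorem integral_inner_smul_eq_zero_of_divergenceFree (hΩ : Bornology.IsBounded Ω)
    {β : Plane → Plane} (hβ : MemLp β ⊤ (area Ω)) (hdiv : IsDivergenceFree Ω β)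
    (hφ : ∀ m, IsTestFunction Ω (φ m)) (h : ApproxH1 Ω φ v G) :
    ∫ x in Ω, inner ℝ (v x • β x) (G x) = 0 := by
  have m1 : ∀ m, MemLp (φ m) 2 (area Ω) := fun m =>
    memLp_of_continuous hΩ (h.contDiff m).continuous
  have t := tendsto_integral_inner (fun m => memLp_smul_of_bounded (m1 m) hβ)
    (fun m => memLp_of_continuous hΩ (continuous_gradient (h.contDiff m)))
    (memLp_smul_of_bounded h.memLp hβ) h.memLp_grad (by
      have := ENNReal.Tendsto.mul_const h.tendsto (b := eLpNorm β ⊤ (area Ω))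
        (.inr hβ.eLpNorm_ne_top)
      rw [zero_mul] at this
      refine tendsto_of_tendsto_of_tendsto_of_le_of_le tendsto_const_nhds this
        (fun _ => zero_le) fun m => ?_
      simp_rw [← sub_smul]
      exact eLpNorm_smul_le_of_memLp_top ((m1 m).sub h.memLp) hβ) h.tendsto_grad
  refine tendsto_nhds_unique t ?_
  refine tendsto_const_nhds.congr fun m => ?_
  have hsq : IsTestFunction Ω (fun x => φ m x ^ 2) := by
    have e : (fun x => φ m x ^ 2) = φ m * φ m := by ext; simp [sq]
    refine ⟨(hφ m).1.pow 2, ?_, ?_⟩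
    · rw [e]; exact (hφ m).2.1.mul_left
    · rw [e]; exact (tsupport_mul_subset_left).trans (hφ m).2.2
  have := hdiv _ hsq
  simp_rw [gradient_sq (hφ m).1, inner_smul_right] at this
  simp_rw [mul_assoc, integral_const_mul] at this
  simp_rw [inner_smul_left]
  simp only [conj_trivial, mul_eq_zero, OfNat.ofNat_ne_zero, false_or] at this ⊢
  exact this.symm

/-- The Gagliardo-Nirenberg-Sobolev inequality for the exponents `4` and `2`. -/
theorem exists_eLpNorm_four_le (hΩ : Bornology.IsBounded Ω) : ∃ C : ENNReal, C ≠ ⊤ ∧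
    ∀ φ : Plane → ℝ, IsTestFunction Ω φ →
      eLpNorm φ 4 (area Ω) ≤ C * eLpNorm (gradient φ) 2 (area Ω) := by
  have hfin := isFiniteMeasure_area hΩ
  -- In dimension 2 the exponent 4 is the Sobolev conjugate of `4/3`; the exponent 2 itself is
  -- critical and excluded by `p < 2`. Hölder on the bounded `Ω` then passes from `4/3` to 2, at the
  -- cost of the factor `A`.
  obtain ⟨p, hp⟩ : ∃ p : NNReal, p = 4 / 3 := ⟨_, rfl⟩
  have hp' : (p : ℝ) = 4 / 3 := by rw [hp]; norm_num
  obtain ⟨q, hq⟩ : ∃ q : NNReal, q = 4 := ⟨_, rfl⟩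
  have hq' : (q : ENNReal) = 4 := by rw [hq]; rfl
  obtain ⟨A, hA⟩ : ∃ A : ENNReal,
    A = area Ω univ ^ (1 / (p : ENNReal).toReal - 1 / (2 : ENNReal).toReal) := ⟨_, rfl⟩
  have hAtop : A ≠ ⊤ := by
    rw [hA]
    refine ENNReal.rpow_ne_top_of_nonneg ?_ (measure_ne_top (area Ω) univ)
    simp [hp']; norm_num
  have hp2 : (p : ENNReal) ≤ 2 := by
    rw [← ENNReal.coe_ofNat, ENNReal.coe_le_coe, ← NNReal.coe_le_coe, hp']; push_cast; norm_num
  have hp1 : 1 ≤ p := by rw [← NNReal.coe_le_coe, hp']; norm_num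
  have hpd : p < Module.finrank ℝ Plane := by
    rw [finrank_euclideanSpace_fin, ← NNReal.coe_lt_coe, hp']; push_cast; norm_num
  have hpq : (p : ℝ)⁻¹ - (Module.finrank ℝ Plane : ℝ)⁻¹ ≤ (q : ℝ)⁻¹ := by
    rw [finrank_euclideanSpace_fin, hp', hq]; push_cast; norm_num
  obtain ⟨B, hB⟩ : ∃ B, B = eLpNormLESNormFDerivOfLeConst ℝ (volume : Measure Plane) Ω p q :=
    ⟨_, rfl⟩
  refine ⟨(B : ENNReal) * A, ENNReal.mul_ne_top ENNReal.coe_ne_top hAtop, ?_⟩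
  intro φ hφ
  have e1 := eLpNorm_le_eLpNorm_fderiv_of_le (F := ℝ) (volume : Measure Plane)
    (hφ.1.of_le (by simp)) ((subset_tsupport _).trans hφ.2.2) hp1 hpd (by exact_mod_cast hpq) hΩ
  rw [← hB] at e1
  have e4 : eLpNorm (fderiv ℝ φ) p volume = eLpNorm (gradient φ) p volume :=
    eLpNorm_congr_norm_ae (.of_forall fun x => (norm_gradient _ _).symm)
  have hs : (gradient φ).support ⊆ Ω := fun x hx => by
    by_contra h
    exact hx (hφ.eq_zero_of_notMem h).2
  have e2 : eLpNorm (gradient φ) p (area Ω) = eLpNorm (gradient φ) p volume :=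
    eLpNorm_restrict_eq_of_support_subset hs
  have e3 : eLpNorm (gradient φ) p (area Ω) ≤ eLpNorm (gradient φ) 2 (area Ω) * A := by
    rw [hA]
    exact eLpNorm_le_eLpNorm_mul_rpow_measure_univ hp2
      (continuous_gradient hφ.1).aestronglyMeasurable
  rw [← hq']
  refine (eLpNorm_mono_measure _ Measure.restrict_le_self).trans (e1.trans ?_)
  rw [e4, ← e2, mul_assoc, mul_comm A]
  gcongr

/-- Hölder with `1/4 + 1/4 = 1/2` applied to the smooth approximants. The sup norm of `r` only
multiplies an error that tends to zero, so the final bound involves the `L⁴` norm of `r` alone. -/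
theorem exists_sobolev_const (hΩ : Bornology.IsBounded Ω) : ∃ C : ℝ, 0 ≤ C ∧
    ∀ φ v G, (∀ m, IsTestFunction Ω (φ m)) → ApproxH1 Ω φ v G →
    ∀ r : Plane → Plane, MemLp r ⊤ (area Ω) →
      eLpNorm (fun x => v x • r x) 2 (area Ω) ≤
        ENNReal.ofReal C * eLpNorm r 4 (area Ω) * eLpNorm G 2 (area Ω) := by
  have hfin := isFiniteMeasure_area hΩ
  obtain ⟨A, hAtop, step⟩ := exists_eLpNorm_four_le hΩ
  refine ⟨A.toReal, by positivity, fun φ v G hφ h r hr => ?_⟩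
  have hr4 : MemLp r 4 (area Ω) := hr.mono_exponent le_top
  have m1 : ∀ m, MemLp (φ m) 2 (area Ω) := fun m =>
    memLp_of_continuous hΩ (h.contDiff m).continuous
  rw [ENNReal.ofReal_toReal hAtop]
  have : ENNReal.HolderTriple 4 4 2 := ⟨by
    rw [← ENNReal.toReal_eq_toReal_iff' (by simp) (by simp), ENNReal.toReal_add (by simp) (by simp)]
    simp; norm_num⟩
  have bound : ∀ m, eLpNorm (fun x => v x • r x) 2 (area Ω) ≤
      eLpNorm (fun x => φ m x - v x) 2 (area Ω) * eLpNorm r ⊤ (area Ω) +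
      A * eLpNorm r 4 (area Ω) *
        (eLpNorm (fun x => gradient (φ m) x - G x) 2 (area Ω) + eLpNorm G 2 (area Ω)) := by
    intro m
    have d1 : (fun x => v x • r x) = (fun x => φ m x • r x) - fun x => (φ m x - v x) • r x := by
      ext1 x; simp [sub_smul]
    have d2 : gradient (φ m) = (fun x => gradient (φ m) x - G x) + G := by
      ext1 x; simp
    have mg := memLp_of_continuous hΩ (continuous_gradient (h.contDiff m))
    have md : MemLp (fun x => φ m x - v x) 2 (area Ω) := (m1 m).sub h.memLp
    have h4 : eLpNorm (fun x => φ m x • r x) 2 (area Ω) ≤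
        eLpNorm (φ m) 4 (area Ω) * eLpNorm r 4 (area Ω) :=
      eLpNorm_smul_le_mul_eLpNorm (hpqr := this) hr.1 (φ := φ m) (m1 m).1
    have h5 : eLpNorm (gradient (φ m)) 2 (area Ω) ≤
        eLpNorm (fun x => gradient (φ m) x - G x) 2 (area Ω) + eLpNorm G 2 (area Ω) := by
      conv_lhs => rw [d2]
      exact eLpNorm_add_le (mg.1.sub h.memLp_grad.1) h.memLp_grad.1 (by norm_num)
    rw [d1]
    refine (eLpNorm_sub_le (memLp_smul_of_bounded (m1 m) hr).1 (memLp_smul_of_bounded md hr).1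
      (by norm_num)).trans ?_
    rw [add_comm]
    gcongr
    · exact eLpNorm_smul_le_of_memLp_top md hr
    · calc _ ≤ _ := h4
        _ ≤ _ := mul_le_mul_left (step _ (hφ m)) _
        _ ≤ A * (eLpNorm (fun x => gradient (φ m) x - G x) 2 (area Ω) +
            eLpNorm G 2 (area Ω)) * eLpNorm r 4 (area Ω) := by gcongr
        _ = _ := by ring
  have t1 := ENNReal.Tendsto.mul_const h.tendsto (b := eLpNorm r ⊤ (area Ω))
    (.inr hr.eLpNorm_ne_top)
  have t2 := ENNReal.Tendsto.const_mul (a := A * eLpNorm r 4 (area Ω))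
    (h.tendsto_grad.add_const (eLpNorm G 2 (area Ω)))
    (.inr (ENNReal.mul_ne_top hAtop hr4.eLpNorm_ne_top))
  have t3 := t1.add t2
  simp only [zero_mul, zero_add] at t3
  exact ge_of_tendsto t3 (.of_forall bound)

/-- The weighted Sobolev inequality in terms of integrals. -/
theorem exists_integral_sobolev_const (hΩ : Bornology.IsBounded Ω) : ∃ C : ℝ, 0 ≤ C ∧
    ∀ φ v G, (∀ m, IsTestFunction Ω (φ m)) → ApproxH1 Ω φ v G →
    ∀ (r : Plane → Plane) (ε : ℝ), 0 ≤ ε → MemLp r ⊤ (area Ω) →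
      eLpNorm r 4 (area Ω) ≤ ENNReal.ofReal ε →
      ∫ x in Ω, ‖v x • r x‖ ^ 2 ≤ (C * ε) ^ 2 * ∫ x in Ω, ‖G x‖ ^ 2 := by
  obtain ⟨C, hC, h⟩ := exists_sobolev_const hΩ
  refine ⟨C, hC, fun φ v G hφ ha r ε hε hr hr4 => ?_⟩
  rw [← eLpNorm_two_le_iff (memLp_smul_of_bounded ha.memLp hr) ha.memLp_grad (by positivity),
    ENNReal.ofReal_mul hC]
  exact (h φ v G hφ ha r hr).trans (by gcongr)

/-- The weighted Sobolev inequality with a constant unit vector as weight. -/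
theorem exists_poincare_const (hΩ : Bornology.IsBounded Ω) : ∃ C : ℝ, 0 ≤ C ∧
    ∀ φ v G, (∀ m, IsTestFunction Ω (φ m)) → ApproxH1 Ω φ v G →
      ∫ x in Ω, ‖v x‖ ^ 2 ≤ C * ∫ x in Ω, ‖G x‖ ^ 2 := by
  have hfin := isFiniteMeasure_area hΩ
  obtain ⟨C, hC, h⟩ := exists_integral_sobolev_const hΩ
  set e : Plane := EuclideanSpace.single 0 1
  have he : MemLp (fun _ : Plane => e) ⊤ (area Ω) := memLp_const e
  have he4 : MemLp (fun _ : Plane => e) 4 (area Ω) := memLp_const e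
  refine ⟨_, sq_nonneg (C * (eLpNorm (fun _ : Plane => e) 4 (area Ω)).toReal),
    fun φ v G hφ ha => ?_⟩
  have := h φ v G hφ ha (fun _ => e) _ ENNReal.toReal_nonneg he
    (ENNReal.ofReal_toReal he4.eLpNorm_ne_top).ge
  simpa [norm_smul, e] using this

end Domain

/-! ### Polynomials, their `L²`-projections and the inverse inequality. -/

section Polynomials

theorem continuous_polyFun (p : Poly) : Continuous (polyFun p) :=
  (MvPolynomial.continuous_eval p).comp (PiLp.continuous_ofLp 2 _)

theorem continuous_polyField (P : Fin 2 → Poly) : Continuous (polyField P) :=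
  (PiLp.continuous_toLp 2 _).comp (continuous_pi fun i => continuous_polyFun (P i))

/-- The ball contains a product of two intervals, and a polynomial vanishing on a product of
infinite sets is zero. -/
theorem eq_zero_of_polyFun_eqOn_ball {p : Poly} {r : ℝ} (hr : 0 < r)
    (h : ∀ x ∈ Metric.ball (0 : Plane) r, polyFun p x = 0) : p = 0 := by
  refine MvPolynomial.funext_set (fun _ : Fin 2 => Ioo (-(r / 2)) (r / 2))
    (fun _ => Ioo_infinite (by linarith)) fun y hy => ?_
  rw [map_zero]
  refine h (WithLp.toLp 2 y) ?_
  have h0 := hy 0 (mem_univ _)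
  have h1 := hy 1 (mem_univ _)
  rw [mem_ball_zero_iff, EuclideanSpace.norm_eq, Real.sqrt_lt' hr, Fin.sum_univ_two]
  simp only [Real.norm_eq_abs, sq_abs]
  simp only [mem_Ioo] at h0 h1
  nlinarith

/-- A linear map factors boundedly through an injective one on a finite-dimensional space. -/
theorem exists_norm_le_of_injective {W A B : Type*} [AddCommGroup W] [Module ℝ W]
    [FiniteDimensional ℝ W] [NormedAddCommGroup A] [NormedSpace ℝ A] [NormedAddCommGroup B]
    [NormedSpace ℝ B] (T : W →ₗ[ℝ] A) (S : W →ₗ[ℝ] B) (hT : Function.Injective T) :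
    ∃ C : ℝ, 0 ≤ C ∧ ∀ w, ‖S w‖ ≤ C * ‖T w‖ := by
  let e := LinearEquiv.ofInjective T hT
  let L := LinearMap.toContinuousLinearMap (S ∘ₗ e.symm.toLinearMap)
  refine ⟨‖L‖, L.opNorm_nonneg, fun w => ?_⟩
  have := L.le_opNorm (e w)
  simpa [L, e] using this

/-- The class in `L²(U)` of a polynomial of degree at most `n`. -/
noncomputable def polyToLp {U : Set Plane} (hU : Bornology.IsBounded U) (n : ℕ) :
    MvPolynomial.restrictTotalDegree (Fin 2) ℝ n →ₗ[ℝ] Lp ℝ 2 (area U) where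
  toFun p := (memLp_of_continuous hU (continuous_polyFun p)).toLp _
  map_add' p q := by
    rw [← MemLp.toLp_add]
    congr 1
    ext x
    simp [polyFun]
  map_smul' c p := by
    rw [RingHom.id_apply, ← MemLp.toLp_const_smul]
    congr 1
    ext x
    simp [polyFun]

theorem exists_isL2Proj {U : Set Plane} (hU : Bornology.IsBounded U) (n : ℕ) {w : Plane → ℝ}
    (hw : MemLp w 2 (area U)) : ∃ p, IsL2Proj U n w p := by
  let K := LinearMap.range (polyToLp hU n)
  obtain ⟨p, hp⟩ : K.starProjection (hw.toLp w) ∈ K := Submodule.starProjection_apply_mem _ _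
  refine ⟨p, (MvPolynomial.mem_restrictTotalDegree ..).1 p.2, fun q hq => ?_⟩
  have h := Submodule.starProjection_inner_eq_zero (K := K) (hw.toLp w)
    (polyToLp hU n ⟨q, (MvPolynomial.mem_restrictTotalDegree ..).2 hq⟩) ⟨_, rfl⟩
  rw [← hp, inner_sub_left, sub_eq_zero, L2.inner_def, L2.inner_def] at h
  have mq := memLp_of_continuous hU (continuous_polyFun q)
  have mp := memLp_of_continuous hU (continuous_polyFun (p : Poly))
  have e1 : ∫ x in U, polyFun p x * polyFun q x =
      ∫ x in U, inner ℝ (mp.toLp _ x) (mq.toLp _ x) := integral_congr_ae (by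
    filter_upwards [mp.coeFn_toLp, mq.coeFn_toLp] with x h1 h2
    rw [h1, h2]; simp [mul_comm])
  have e2 : ∫ x in U, w x * polyFun q x =
      ∫ x in U, inner ℝ (hw.toLp _ x) (mq.toLp _ x) := integral_congr_ae (by
    filter_upwards [hw.coeFn_toLp, mq.coeFn_toLp] with x h1 h2
    rw [h1, h2]; simp [mul_comm])
  rw [e1, e2]
  exact h.symm

theorem isL2Proj_l2Proj {U : Set Plane} (hU : Bornology.IsBounded U) (n : ℕ) {w : Plane → ℝ}
    (hw : MemLp w 2 (area U)) : IsL2Proj U n w (l2Proj U n w) := by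
  have h := exists_isL2Proj hU n hw
  rw [l2Proj, dif_pos h]
  exact h.choose_spec

/-- `P` consists of `L²(U)`-projections of the components of `G`. -/
def IsL2ProjField (U : Set Plane) (n : ℕ) (G : Plane → Plane) (P : Fin 2 → Poly) : Prop :=
  ∀ i, IsL2Proj U n (fun x => G x i) (P i)

theorem isL2ProjField_l2ProjField {U : Set Plane} (hU : Bornology.IsBounded U) (n : ℕ)
    {G : Plane → Plane} (hG : MemLp G 2 (area U)) :
    IsL2ProjField U n G (l2ProjField U n G) := fun i => isL2Proj_l2Proj hU n (hG.eval_piLp i)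

theorem IsL2ProjField.congr {U : Set Plane} {n : ℕ} {G G' : Plane → Plane} {P : Fin 2 → Poly}
    (h : IsL2ProjField U n G P) (hG : G =ᵐ[area U] G') : IsL2ProjField U n G' P := fun i =>
  ⟨(h i).1, fun q hq => ((h i).2 q hq).trans (integral_congr_ae (hG.mono fun x hx => by
    simp only [hx]))⟩

variable {U : Set Plane} {n : ℕ}

theorem IsL2Proj.integral_sub_mul (hU : Bornology.IsBounded U) {w : Plane → ℝ} {p q : Poly}
    (hw : MemLp w 2 (area U)) (h : IsL2Proj U n w p) (hq : q.totalDegree ≤ n) :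
    ∫ x in U, (w x - polyFun p x) * polyFun q x = 0 := by
  have mq := memLp_of_continuous hU (continuous_polyFun q)
  have mp := memLp_of_continuous hU (continuous_polyFun p)
  have e := integral_sub (hw.integrable_mul mq) (mp.integrable_mul mq)
  simp only [Pi.mul_apply] at e
  simp_rw [sub_mul]
  rw [e, h.2 q hq, sub_self]

theorem IsL2ProjField.integral_inner_sub (hU : Bornology.IsBounded U) {G : Plane → Plane}
    {P Q : Fin 2 → Poly} (hG : MemLp G 2 (area U)) (h : IsL2ProjField U n G P)
    (hQ : ∀ i, (Q i).totalDegree ≤ n) :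
    ∫ x in U, inner ℝ (G x - polyField P x) (polyField Q x) = 0 := by
  have mQ := memLp_of_continuous hU (continuous_polyField Q)
  have mP := memLp_of_continuous hU (continuous_polyField P)
  have m := hG.sub mP
  have e : ∀ x, inner ℝ (G x - polyField P x) (polyField Q x) =
      ∑ i, (G x i - polyFun (P i) x) * polyFun (Q i) x := fun x => by
    simp [PiLp.inner_apply, polyField, mul_comm]
  simp_rw [e]
  rw [integral_finsetSum]
  · exact Finset.sum_eq_zero fun i _ => (h i).integral_sub_mul hU (hG.eval_piLp i) (hQ i)
  · exact fun i _ => (m.eval_piLp i).integrable_mul (mQ.eval_piLp i)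

theorem IsL2ProjField.integral_normSq (hU : Bornology.IsBounded U) {G : Plane → Plane}
    {P : Fin 2 → Poly} (hG : MemLp G 2 (area U)) (h : IsL2ProjField U n G P) :
    ∫ x in U, ‖G x‖ ^ 2 =
      (∫ x in U, ‖G x - polyField P x‖ ^ 2) + ∫ x in U, ‖polyField P x‖ ^ 2 := by
  have mP := memLp_of_continuous hU (continuous_polyField P)
  have := integral_normSq_sub_add hG mP (q := fun _ => (0 : Plane)) MemLp.zero' (by
    simpa using h.integral_inner_sub hU hG fun i => (h i).1)
  simp only [sub_zero] at this
  exact this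

/-- The `L²`-projection is the best approximation. -/
theorem IsL2Proj.integral_normSq_sub_le (hU : Bornology.IsBounded U) {w : Plane → ℝ} {p : Poly}
    (hw : MemLp w 2 (area U)) (h : IsL2Proj U n w p) {q : Poly} (hq : q.totalDegree ≤ n) :
    ∫ x in U, ‖w x - polyFun p x‖ ^ 2 ≤ ∫ x in U, ‖w x - polyFun q x‖ ^ 2 := by
  have mp := memLp_of_continuous hU (continuous_polyFun p)
  have mq := memLp_of_continuous hU (continuous_polyFun q)
  have e : ∀ x, polyFun p x - polyFun q x = polyFun (p - q) x := fun x => by simp [polyFun]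
  rw [integral_normSq_sub_add hw mp mq]
  · have : 0 ≤ ∫ x in U, ‖polyFun p x - polyFun q x‖ ^ 2 := by positivity
    linarith
  · simp_rw [e, RCLike.inner_apply, conj_trivial, mul_comm (polyFun (p - q) _)]
    exact h.integral_sub_mul hU hw ((MvPolynomial.totalDegree_sub _ _).trans (max_le h.1 hq))

/-! ### The inverse inequality -/

/-- The polynomial `p (c + h x)`. -/
noncomputable def polyRescale (c : Plane) (h : ℝ) (p : Poly) : Poly :=
  MvPolynomial.bind₁ (fun i => MvPolynomial.C (c i) + MvPolynomial.C h * MvPolynomial.X i) p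

theorem polyFun_polyRescale (c : Plane) (h : ℝ) (p : Poly) (x : Plane) :
    polyFun (polyRescale c h p) x = polyFun p (c + h • x) := by
  simp only [polyFun, polyRescale, MvPolynomial.bind₁, ← MvPolynomial.coe_aeval_eq_eval]
  rw [RingHom.coe_coe, RingHom.coe_coe, MvPolynomial.comp_aeval_apply]
  simp

theorem totalDegree_polyRescale_le (c : Plane) (h : ℝ) (p : Poly) :
    (polyRescale c h p).totalDegree ≤ p.totalDegree := by
  rw [polyRescale, MvPolynomial.bind₁, MvPolynomial.aeval_def, MvPolynomial.eval₂_eq]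
  refine MvPolynomial.totalDegree_finsetSum_le fun d hd => ?_
  refine (MvPolynomial.totalDegree_mul _ _).trans ?_
  rw [MvPolynomial.algebraMap_eq, MvPolynomial.totalDegree_C, zero_add]
  refine (MvPolynomial.totalDegree_finsetProd _ _).trans ?_
  refine le_trans (Finset.sum_le_sum fun i _ => ?_) (MvPolynomial.le_totalDegree hd)
  refine (MvPolynomial.totalDegree_pow _ _).trans (mul_le_of_le_one_right (Nat.zero_le _) ?_)
  refine (MvPolynomial.totalDegree_add _ _).trans (max_le (by simp) ?_)
  refine (MvPolynomial.totalDegree_mul _ _).trans ?_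
  simp

theorem pderiv_polyRescale (c : Plane) (h : ℝ) (p : Poly) (i : Fin 2) :
    MvPolynomial.pderiv i (polyRescale c h p) =
      h • polyRescale c h (MvPolynomial.pderiv i p) := by
  unfold polyRescale
  induction p using MvPolynomial.induction_on with
  | C a => simp
  | add p q hp hq => simp only [map_add, hp, hq, smul_add]
  | mul_X p j hp =>
    simp only [map_mul, Derivation.leibniz, hp, MvPolynomial.bind₁_X_right, map_add,
      MvPolynomial.pderiv_C, MvPolynomial.pderiv_X, smul_eq_mul, MvPolynomial.smul_eq_C_mul,
      Pi.single_apply]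
    split_ifs <;> simp <;> ring

theorem polyDiv_polyRescale (c : Plane) (h : ℝ) (P : Fin 2 → Poly) (x : Plane) :
    polyFun (polyDiv fun i => polyRescale c h (P i)) x = h * polyFun (polyDiv P) (c + h • x) := by
  rw [← polyFun_polyRescale]
  simp only [polyDiv, pderiv_polyRescale, Fin.sum_univ_two]
  simp [polyFun, polyRescale, mul_add]

theorem setIntegral_comp_add_smul {f : Plane → ℝ} {c : Plane} {h : ℝ} (hh : 0 < h) {S T : Set Plane}
    (hS : MeasurableSet S) (hT : MeasurableSet T) (hST : ∀ x, c + h • x ∈ T ↔ x ∈ S) :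
    ∫ x in T, f x = h ^ 2 * ∫ x in S, f (c + h • x) := by
  have e : S.indicator (fun x => f (c + h • x)) = fun x => T.indicator f (c + h • x) := by
    ext x
    by_cases hx : x ∈ S
    · simp [hx, (hST x).2 hx]
    · simp [hx, mt (hST x).1 hx]
  rw [← integral_indicator hT, ← integral_indicator hS, e,
    Measure.integral_comp_smul volume (fun x => T.indicator f (c + x)) h,
    integral_add_left_eq_self, finrank_euclideanSpace_fin, abs_of_pos (by positivity), smul_eq_mul]
  field_simp

/-- After rescaling by `x ↦ c + h x`, the set `U` lies between the ball of radius `κ` and the closed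
unit ball. On the finite-dimensional space of polynomial fields, the `L²` norm over the small ball
dominates the `L²` norm of the divergence over the large one, so the constant does not see the shape
of `U`. -/
theorem exists_inverse_ineq (n : ℕ) {κ : ℝ} (hκ : 0 < κ) : ∃ C : ℝ, 0 ≤ C ∧
    ∀ (U : Set Plane) (c : Plane) (h : ℝ), 0 < h → MeasurableSet U → Metric.ball c (κ * h) ⊆ U →
      U ⊆ Metric.closedBall c h → ∀ P : Fin 2 → Poly, (∀ i, (P i).totalDegree ≤ n) →
      h ^ 2 * ∫ x in U, ‖polyFun (polyDiv P) x‖ ^ 2 ≤ C * ∫ x in U, ‖polyField P x‖ ^ 2 := by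
  have bA : Bornology.IsBounded (Metric.ball (0 : Plane) κ) := Metric.isBounded_ball
  have bB : Bornology.IsBounded (Metric.closedBall (0 : Plane) 1) := Metric.isBounded_closedBall
  let T : (Fin 2 → MvPolynomial.restrictTotalDegree (Fin 2) ℝ n) →ₗ[ℝ]
      Lp Plane 2 (area (Metric.ball (0 : Plane) κ)) :=
    { toFun P := (memLp_of_continuous bA (continuous_polyField fun i => (P i : Poly))).toLp _
      map_add' P Q := by
        rw [← MemLp.toLp_add]
        congr 1; ext x i; simp [polyField, polyFun]
      map_smul' a P := by
        rw [RingHom.id_apply, ← MemLp.toLp_const_smul]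
        congr 1; ext x i; simp [polyField, polyFun] }
  let S : (Fin 2 → MvPolynomial.restrictTotalDegree (Fin 2) ℝ n) →ₗ[ℝ]
      Lp ℝ 2 (area (Metric.closedBall (0 : Plane) 1)) :=
    { toFun P := (memLp_of_continuous bB
        (continuous_polyFun (polyDiv fun i => (P i : Poly)))).toLp _
      map_add' P Q := by
        rw [← MemLp.toLp_add]
        congr 1; ext x; simp [polyDiv, polyFun]; ring
      map_smul' a P := by
        rw [RingHom.id_apply, ← MemLp.toLp_const_smul]
        congr 1; ext x; simp [polyDiv, polyFun]; ring }
  -- A field vanishing almost everywhere on the small ball vanishes there by continuity, hence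
  -- identically.
  have hT : Function.Injective T := by
    rw [injective_iff_map_eq_zero]
    intro P hP
    have h0 : polyField (fun i => (P i : Poly)) =ᵐ[area (Metric.ball (0 : Plane) κ)] 0 :=
      (MemLp.coeFn_toLp (memLp_of_continuous bA
        (continuous_polyField fun i => (P i : Poly)))).symm.trans
        ((Lp.eq_zero_iff_ae_eq_zero).1 hP)
    have h1 := Measure.eqOn_open_of_ae_eq h0 Metric.isOpen_ball
      (continuous_polyField _).continuousOn continuousOn_const
    funext i
    refine Subtype.ext (eq_zero_of_polyFun_eqOn_ball hκ fun x hx => ?_)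
    exact congrArg (fun y : Plane => y i) (h1 hx)
  obtain ⟨C, hC, hST⟩ := exists_norm_le_of_injective T S hT
  refine ⟨C ^ 2, sq_nonneg C, fun U c h hh hU hBU hUB P hP => ?_⟩
  let Q : Fin 2 → MvPolynomial.restrictTotalDegree (Fin 2) ℝ n := fun i =>
    ⟨polyRescale c h (P i), (MvPolynomial.mem_restrictTotalDegree ..).2
    ((totalDegree_polyRescale_le c h (P i)).trans (hP i))⟩
  have key : ∫ x in Metric.closedBall (0 : Plane) 1,
      ‖polyFun (polyDiv fun i => polyRescale c h (P i)) x‖ ^ 2 ≤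
      C ^ 2 * ∫ x in Metric.ball (0 : Plane) κ,
        ‖polyField (fun i => polyRescale c h (P i)) x‖ ^ 2 := by
    have := hST Q
    simp only [S, T, Q, LinearMap.coe_mk, AddHom.coe_mk, Lp.norm_toLp] at this
    have m1 := memLp_of_continuous bB (continuous_polyFun (polyDiv fun i => polyRescale c h (P i)))
    have m2 := memLp_of_continuous bA (continuous_polyField fun i => polyRescale c h (P i))
    rw [toReal_eLpNorm m1.1, toReal_eLpNorm m2.1] at this
    rw [← lpNorm_two_sq m1, ← lpNorm_two_sq m2, ← mul_pow]
    exact pow_le_pow_left₀ lpNorm_nonneg this 2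
  have e1 : ∀ x, polyField (fun i => polyRescale c h (P i)) x = polyField P (c + h • x) := by
    intro x; ext i; simp [polyField, polyFun_polyRescale]
  simp_rw [polyDiv_polyRescale, e1, norm_mul, mul_pow, integral_const_mul] at key
  have i1 := setIntegral_comp_add_smul (f := fun x => ‖polyFun (polyDiv P) x‖ ^ 2) hh
    (c := c) (S := Metric.closedBall (0 : Plane) 1) (T := Metric.closedBall c h)
    measurableSet_closedBall measurableSet_closedBall fun x => by
      simp [norm_smul, abs_of_pos hh, hh]
  have i2 := setIntegral_comp_add_smul (f := fun x => ‖polyField P x‖ ^ 2) hh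
    (c := c) (S := Metric.ball (0 : Plane) κ) (T := Metric.ball c (κ * h))
    measurableSet_ball measurableSet_ball fun x => by
      simp [norm_smul, abs_of_pos hh, mul_comm κ, hh]
  have j1 : ∫ x in U, ‖polyFun (polyDiv P) x‖ ^ 2 ≤
      ∫ x in Metric.closedBall c h, ‖polyFun (polyDiv P) x‖ ^ 2 :=
    setIntegral_mono_set (integrable_normSq (memLp_of_continuous Metric.isBounded_closedBall
      (continuous_polyFun _))) (.of_forall fun _ => sq_nonneg _) hUB.eventuallyLE
  have j2 : ∫ x in Metric.ball c (κ * h), ‖polyField P x‖ ^ 2 ≤ ∫ x in U, ‖polyField P x‖ ^ 2 :=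
    setIntegral_mono_set (integrable_normSq (memLp_of_continuous
      (Metric.isBounded_closedBall.subset hUB) (continuous_polyField _)))
      (.of_forall fun _ => sq_nonneg _) hBU.eventuallyLE
  have hn : ‖h‖ ^ 2 = h ^ 2 := by rw [Real.norm_eq_abs, sq_abs]
  rw [hn] at key
  calc _ ≤ _ := mul_le_mul_of_nonneg_left j1 (sq_nonneg h)
    _ ≤ h ^ 2 * (C ^ 2 * _) := mul_le_mul_of_nonneg_left (i1 ▸ key) (sq_nonneg h)
    _ = C ^ 2 * ∫ x in Metric.ball c (κ * h), ‖polyField P x‖ ^ 2 := by rw [i2]; ring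
    _ ≤ _ := mul_le_mul_of_nonneg_left j2 (sq_nonneg C)

end Polynomials

/-! ### The Poincaré inequality on star-shaped sets. -/

section Poincare

open scoped ENNReal

theorem lintegral_comp_add_smul {g : Plane → ℝ≥0∞} (hg : Measurable g) (z : Plane) {s : ℝ}
    (hs : 0 < s) : ∫⁻ x, g (z + s • x) = ENNReal.ofReal (s ^ 2)⁻¹ * ∫⁻ x, g x := by
  have h1 : ∫⁻ x : Plane, g (z + x) = ∫⁻ x, g x := lintegral_add_left_eq_self g z
  have h2 : Measurable fun x : Plane => g (z + x) := hg.comp (measurable_const_add z)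
  rw [← h1, ← lintegral_map (f := fun x => g (z + x)) (g := fun x : Plane => s • x) h2
    (measurable_const_smul s), Measure.map_addHaar_smul volume hs.ne', lintegral_smul_measure,
    finrank_euclideanSpace_fin, abs_of_pos (by positivity), smul_eq_mul]

theorem setLIntegral_comp_add_smul_le {g : Plane → ℝ≥0∞} (hg : Measurable g) {S U : Set Plane}
    (hS : MeasurableSet S) (hU : MeasurableSet U) {z : Plane} {s : ℝ} (hs : 1 / 2 ≤ s)
    (h : ∀ x ∈ S, z + s • x ∈ U) : ∫⁻ x in S, g (z + s • x) ≤ 4 * ∫⁻ x in U, g x := by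
  have h4 : ENNReal.ofReal (s ^ 2)⁻¹ ≤ 4 := by
    rw [← ENNReal.ofReal_ofNat]
    refine ENNReal.ofReal_le_ofReal ?_
    rw [inv_le_comm₀ (by positivity) (by norm_num)]
    nlinarith
  rw [← lintegral_indicator hU]
  calc ∫⁻ x in S, g (z + s • x) = ∫⁻ x in S, U.indicator g (z + s • x) :=
        setLIntegral_congr_fun hS fun x hx => by rw [indicator_of_mem (h x hx)]
    _ ≤ ∫⁻ x, U.indicator g (z + s • x) := setLIntegral_le_lintegral _ _
    _ = _ := lintegral_comp_add_smul (hg.indicator hU) z (by linarith)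
    _ ≤ _ := mul_le_mul_left h4 _

/-- The fundamental theorem of calculus along the segment from `y` to `x`, then comparison of the
`L¹` and `L²` norms on the probability space `(0, 1]`. -/
theorem enorm_sub_sq_le_lintegral {φ : Plane → ℝ} (hφ : ContDiff ℝ ∞ φ) (x y : Plane) {h : ℝ}
    (hxy : dist x y ≤ h) :
    ‖φ x - φ y‖ₑ ^ 2 ≤ ENNReal.ofReal (h ^ 2) *
      ∫⁻ t in Ioc (0 : ℝ) 1, ‖gradient φ (y + t • (x - y))‖ₑ ^ 2 := by
  have hh : 0 ≤ h := dist_nonneg.trans hxy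
  have cg : Continuous fun t : ℝ => fderiv ℝ φ (y + t • (x - y)) (x - y) :=
    ((hφ.continuous_fderiv (by simp)).comp (by fun_prop)).clm_apply continuous_const
  have cG : Continuous fun t : ℝ => gradient φ (y + t • (x - y)) :=
    (continuous_gradient hφ).comp (by fun_prop)
  have hd : ∀ t : ℝ, HasDerivAt (fun t : ℝ => φ (y + t • (x - y)))
      (fderiv ℝ φ (y + t • (x - y)) (x - y)) t := fun t => by
    have h1 : HasDerivAt (fun t : ℝ => y + t • (x - y)) (x - y) t := by
      simpa using ((hasDerivAt_id t).smul_const (x - y)).const_add y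
    exact ((hφ.differentiable (by simp) _).hasFDerivAt).comp_hasDerivAt t h1
  have ftc := intervalIntegral.integral_eq_sub_of_hasDerivAt (a := 0) (b := 1)
    (fun t _ => hd t) (cg.intervalIntegrable _ _)
  simp only [one_smul, zero_smul, add_zero, add_sub_cancel] at ftc
  rw [intervalIntegral.integral_of_le zero_le_one] at ftc
  have hp : IsProbabilityMeasure (volume.restrict (Ioc (0 : ℝ) 1)) := ⟨by simp⟩
  have e1 : ‖φ x - φ y‖ₑ ≤ ENNReal.ofReal h *
      eLpNorm (fun t : ℝ => gradient φ (y + t • (x - y))) 1 (volume.restrict (Ioc (0 : ℝ) 1)) := by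
    rw [← ftc, eLpNorm_one_eq_lintegral_enorm, ← lintegral_const_mul' _ _ (by simp)]
    refine (enorm_integral_le_lintegral_enorm _).trans (lintegral_mono fun t => ?_)
    rw [← ofReal_norm, ← ofReal_norm, ← ENNReal.ofReal_mul hh, norm_gradient]
    refine ENNReal.ofReal_le_ofReal ((ContinuousLinearMap.le_opNorm _ _).trans ?_)
    rw [mul_comm, ← dist_eq_norm]
    gcongr
  have e2 : eLpNorm (fun t : ℝ => gradient φ (y + t • (x - y))) 1
      (volume.restrict (Ioc (0 : ℝ) 1)) ≤ eLpNorm (fun t : ℝ => gradient φ (y + t • (x - y))) 2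
      (volume.restrict (Ioc (0 : ℝ) 1)) :=
    eLpNorm_le_eLpNorm_of_exponent_le (by norm_num) cG.aestronglyMeasurable
  have e3 := eLpNorm_nnreal_pow_eq_lintegral (μ := volume.restrict (Ioc (0 : ℝ) 1))
    (f := fun t : ℝ => gradient φ (y + t • (x - y))) (p := 2) (by norm_num)
  simp only [NNReal.coe_ofNat, ENNReal.coe_ofNat, ENNReal.rpow_ofNat] at e3
  calc _ ≤ (ENNReal.ofReal h * _) ^ 2 := pow_le_pow_left' (e1.trans (mul_le_mul_right e2 _)) 2
    _ = _ := by rw [mul_pow, e3, ENNReal.ofReal_pow hh]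

/-- The segment estimate is integrated over `x ∈ U` and `y` in the ball `B`; star-shapedness keeps
every segment inside `U`. The constant `a` is the value of `φ` at a well-chosen point of `B`, and
`κ⁻²` bounds the ratio of the areas of `U` and `B`. -/
theorem exists_lintegral_sub_le {U : Set Plane} (hU : IsOpen U) {c : Plane} {h κ : ℝ} (hh : 0 < h)
    (hκ : 0 < κ) (hstar : ∀ y ∈ Metric.ball c (κ * h), StarConvex ℝ y U)
    (hBU : Metric.ball c (κ * h) ⊆ U) (hUB : U ⊆ Metric.closedBall c h)
    (hdiam : ∀ x ∈ U, ∀ y ∈ U, dist x y ≤ h) {φ : Plane → ℝ} (hφ : ContDiff ℝ ∞ φ) :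
    ∃ a : ℝ, ∫⁻ x in U, ‖φ x - a‖ₑ ^ 2 ≤
      ENNReal.ofReal (4 * h ^ 2 / κ ^ 2) * ∫⁻ x in U, ‖gradient φ x‖ₑ ^ 2 := by
  set B := Metric.ball c (κ * h)
  have mU := hU.measurableSet
  have mB : MeasurableSet B := measurableSet_ball
  set g : Plane → ℝ≥0∞ := fun x => ‖gradient φ x‖ₑ ^ 2 with hg
  have cgr : Continuous g := (ENNReal.continuous_pow 2).comp (continuous_gradient hφ).enorm
  have mg : Measurable g := cgr.measurable
  set I := ∫⁻ x in U, g x with hI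
  have hmem : ∀ x ∈ U, ∀ y ∈ B, ∀ t : ℝ, 0 ≤ t → t ≤ 1 → y + t • (x - y) ∈ U := by
    intro x hx y hy t h0 h1
    have := hstar y hy hx (sub_nonneg.2 h1) h0 (by ring)
    convert this using 1
    module
  have J : ∀ t ∈ Ioc (0 : ℝ) 1, ∫⁻ y in B, ∫⁻ x in U, g (y + t • (x - y)) ≤ 4 * I * volume U := by
    intro t ht
    -- The point `y + t (x - y)` scales by `t` in `x` and by `1 - t` in `y`. Changing variables in
    -- whichever has factor at least `1/2` keeps the inverse Jacobian at most 4 and avoids a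
    -- singularity at either end.
    rcases le_total (1 / 2) t with h2 | h2
    · calc _ ≤ ∫⁻ y in B, 4 * I := setLIntegral_mono measurable_const fun y hy => by
            have e : ∀ x, y + t • (x - y) = (y - t • y) + t • x := fun x => by module
            simp_rw [e]
            refine setLIntegral_comp_add_smul_le mg mU mU h2 fun x hx => ?_
            rw [← e]
            exact hmem x hx y hy t ht.1.le ht.2
        _ ≤ _ := by rw [setLIntegral_const]; gcongr
    · rw [lintegral_lintegral_swap (by
        refine Measurable.aemeasurable (Continuous.measurable ?_)
        exact cgr.comp (by fun_prop))]
      calc _ ≤ ∫⁻ x in U, 4 * I := setLIntegral_mono measurable_const fun x hx => by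
            have e : ∀ y, y + t • (x - y) = t • x + (1 - t) • y := fun y => by module
            simp_rw [e]
            refine setLIntegral_comp_add_smul_le mg mB mU (by linarith) fun y hy => ?_
            rw [← e]
            exact hmem x hx y hy t ht.1.le ht.2
        _ ≤ _ := by rw [setLIntegral_const]
  have total : ∫⁻ y in B, ∫⁻ x in U, ‖φ x - φ y‖ₑ ^ 2 ≤
      ENNReal.ofReal (h ^ 2) * (4 * I * volume U) := by
    calc ∫⁻ y in B, ∫⁻ x in U, ‖φ x - φ y‖ₑ ^ 2
        ≤ ∫⁻ y in B, ∫⁻ x in U, ENNReal.ofReal (h ^ 2) *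
            ∫⁻ t in Ioc (0 : ℝ) 1, g (y + t • (x - y)) := by
          refine setLIntegral_mono' mB fun y hy => setLIntegral_mono' mU fun x hx => ?_
          exact enorm_sub_sq_le_lintegral hφ x y (hdiam x hx y (hBU hy))
      _ = ENNReal.ofReal (h ^ 2) * ∫⁻ y in B, ∫⁻ x in U, ∫⁻ t in Ioc (0 : ℝ) 1,
            g (y + t • (x - y)) := by
          simp_rw [lintegral_const_mul' _ _ ENNReal.ofReal_ne_top]
      _ = ENNReal.ofReal (h ^ 2) * ∫⁻ t in Ioc (0 : ℝ) 1, ∫⁻ y in B, ∫⁻ x in U,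
            g (y + t • (x - y)) := by
          congr 1
          have s1 : ∀ y, ∫⁻ x in U, ∫⁻ t in Ioc (0 : ℝ) 1, g (y + t • (x - y)) =
              ∫⁻ t in Ioc (0 : ℝ) 1, ∫⁻ x in U, g (y + t • (x - y)) := fun y =>
            lintegral_lintegral_swap (Continuous.measurable
              (cgr.comp (by fun_prop))).aemeasurable
          simp_rw [s1]
          refine lintegral_lintegral_swap (Measurable.aemeasurable ?_)
          have : Measurable fun q : (Plane × ℝ) × Plane => g (q.1.1 + q.1.2 • (q.2 - q.1.1)) :=
            Continuous.measurable (cgr.comp (by fun_prop))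
          exact this.lintegral_prod_right'
      _ ≤ ENNReal.ofReal (h ^ 2) * ∫⁻ t in Ioc (0 : ℝ) 1, 4 * I * volume U := by
          exact mul_le_mul_right (setLIntegral_mono measurable_const J) _
      _ = _ := by simp
  have vB0 : volume B ≠ 0 := (Metric.measure_ball_pos volume c (by positivity)).ne'
  have vBt : volume B ≠ ⊤ := measure_ball_lt_top.ne
  -- Some `y` does no worse than the average over `B`.
  obtain ⟨y, -, hy⟩ := exists_le_setLAverage vB0 vBt
    (f := fun y => ∫⁻ x in U, ‖φ x - φ y‖ₑ ^ 2) (by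
      have : Measurable fun q : Plane × Plane => ‖φ q.2 - φ q.1‖ₑ ^ 2 :=
        Continuous.measurable (by have := hφ.continuous; fun_prop)
      exact this.lintegral_prod_right'.aemeasurable)
  refine ⟨φ y, hy.trans ?_⟩
  rw [setLAverage_eq, ENNReal.div_le_iff vB0 vBt]
  refine total.trans ?_
  have vU : volume U ≤ ENNReal.ofReal (1 / κ ^ 2) * volume B := by
    refine (measure_mono hUB).trans_eq ?_
    rw [Measure.addHaar_closedBall _ _ hh.le, Measure.addHaar_ball volume c (by positivity), ← mul_assoc,
      ← ENNReal.ofReal_mul (by positivity), finrank_euclideanSpace_fin]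
    congr 2
    field_simp
  calc _ ≤ ENNReal.ofReal (h ^ 2) * (4 * I * (ENNReal.ofReal (1 / κ ^ 2) * volume B)) := by gcongr
    _ = (4 * ENNReal.ofReal (h ^ 2) * ENNReal.ofReal (1 / κ ^ 2)) * I * volume B := by ring
    _ = _ := by
      rw [← ENNReal.ofReal_ofNat, ← ENNReal.ofReal_mul (by norm_num),
        ← ENNReal.ofReal_mul (by positivity)]
      congr 3; ring

/-- The Poincaré inequality for the projection error on a star-shaped domain. -/
theorem IsL2Proj.poincare {U : Set Plane} (hU : IsOpen U) {c : Plane} {h κ : ℝ} (hh : 0 < h)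
    (hκ : 0 < κ) (hstar : ∀ y ∈ Metric.ball c (κ * h), StarConvex ℝ y U)
    (hBU : Metric.ball c (κ * h) ⊆ U) (hUB : U ⊆ Metric.closedBall c h)
    (hdiam : ∀ x ∈ U, ∀ y ∈ U, dist x y ≤ h) {φ : ℕ → Plane → ℝ} {v : Plane → ℝ}
    {G : Plane → Plane} (hv : ApproxH1 U φ v G) {n : ℕ} {p : Poly} (hp : IsL2Proj U n v p) :
    ∫ x in U, ‖v x - polyFun p x‖ ^ 2 ≤ 4 / κ ^ 2 * h ^ 2 * ∫ x in U, ‖G x‖ ^ 2 := by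
  have bU : Bornology.IsBounded U := Metric.isBounded_closedBall.subset hUB
  have mp := memLp_of_continuous bU (continuous_polyFun p)
  have hc : (4 / κ ^ 2 * h ^ 2 : ℝ) = (2 * h / κ) ^ 2 := by field_simp; norm_num
  rw [hc]
  refine (eLpNorm_two_le_iff (hv.memLp.sub mp) hv.memLp_grad (by positivity)).1 ?_
  have sq : ∀ {F : Type} [NormedAddCommGroup F] (f : Plane → F),
      eLpNorm f 2 (area U) ^ 2 = ∫⁻ x in U, ‖f x‖ₑ ^ 2 := fun f => by
    have := eLpNorm_nnreal_pow_eq_lintegral (μ := area U) (f := f) (p := 2) (by norm_num)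
    simpa using this
  have bound : ∀ m, eLpNorm (v - polyFun p) 2 (area U) ≤
      eLpNorm (fun x => φ m x - v x) 2 (area U) + ENNReal.ofReal (2 * h / κ) *
        (eLpNorm (fun x => gradient (φ m) x - G x) 2 (area U) + eLpNorm G 2 (area U)) := by
    intro m
    have m1 := memLp_of_continuous bU (hv.contDiff m).continuous
    have mg := memLp_of_continuous bU (continuous_gradient (hv.contDiff m))
    obtain ⟨a, ha⟩ := exists_lintegral_sub_le hU hh hκ hstar hBU hUB hdiam (hv.contDiff m)
    have ma := memLp_of_continuous bU (continuous_const (y := a))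
    -- Constants have degree 0, so `a` is an admissible competitor for the projection whatever `n`
    -- is.
    have h1 : eLpNorm (v - polyFun p) 2 (area U) ≤ eLpNorm (fun x => v x - a) 2 (area U) := by
      have := (eLpNorm_two_le_iff (hv.memLp.sub mp) (hv.memLp.sub ma) zero_le_one).2 (by
        have := hp.integral_normSq_sub_le bU hv.memLp (q := MvPolynomial.C a) (by simp)
        simpa [polyFun] using! this)
      simpa using! this
    have h2 : eLpNorm (fun x => φ m x - a) 2 (area U) ≤
        ENNReal.ofReal (2 * h / κ) * eLpNorm (gradient (φ m)) 2 (area U) := by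
      rw [← ENNReal.pow_le_pow_left_iff two_ne_zero, mul_pow, sq, sq,
        ← ENNReal.ofReal_pow (by positivity), ← hc]
      convert ha using 3
      ring
    have h3 : eLpNorm (fun x => v x - a) 2 (area U) ≤
        eLpNorm (fun x => φ m x - v x) 2 (area U) + eLpNorm (fun x => φ m x - a) 2 (area U) := by
      have d : (fun x => v x - a) = (fun x => φ m x - a) - fun x => φ m x - v x := by
        ext x; simp
      rw [d, add_comm]
      exact eLpNorm_sub_le (m1.1.sub ma.1) (m1.1.sub hv.memLp.1) (by norm_num)
    have h4 : eLpNorm (gradient (φ m)) 2 (area U) ≤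
        eLpNorm (fun x => gradient (φ m) x - G x) 2 (area U) + eLpNorm G 2 (area U) := by
      have d : gradient (φ m) = (fun x => gradient (φ m) x - G x) + G := by ext1 x; simp
      conv_lhs => rw [d]
      exact eLpNorm_add_le (mg.1.sub hv.memLp_grad.1) hv.memLp_grad.1 (by norm_num)
    refine h1.trans (h3.trans ?_)
    gcongr
    exact h2.trans (by gcongr)
  have t1 := hv.tendsto.add (ENNReal.Tendsto.const_mul (a := ENNReal.ofReal (2 * h / κ))
    (hv.tendsto_grad.add_const (eLpNorm G 2 (area U))) (.inr ENNReal.ofReal_ne_top))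
  simp only [zero_add] at t1
  exact ge_of_tendsto t1 (.of_forall bound)

end Poincare

/-! ### Mesh geometry and bounds on the SUPG parameter. -/

section Mesh

theorem volume_affineSegment (p q : Plane) : volume (affineSegment ℝ p q) = 0 := by
  refine measure_mono_null (t := (AffineSubspace.mk' p (ℝ ∙ (q - p)) : Set Plane)) ?_
    (Measure.addHaar_affineSubspace _ _ fun h => ?_)
  · rintro _ ⟨t, -, rfl⟩
    simp only [SetLike.mem_coe, AffineSubspace.mem_mk', AffineMap.lineMap_apply, vsub_eq_sub,
      vadd_eq_add, add_sub_cancel_right]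
    exact Submodule.smul_mem _ _ (Submodule.mem_span_singleton_self _)
  · have h1 := congrArg AffineSubspace.direction h
    rw [AffineSubspace.direction_mk', AffineSubspace.direction_top] at h1
    have h2 := finrank_span_finset_le_card (R := ℝ) ({q - p} : Finset Plane)
    rw [Finset.coe_singleton, Finset.card_singleton, Set.finrank, h1, finrank_top,
      finrank_euclideanSpace_fin] at h2
    omega

namespace Element

theorem volume_frontier (E : Element) : volume (frontier E.carrier) = 0 := by
  rw [E.frontier_eq, Polygon.boundary, measure_iUnion_null_iff]
  exact fun i => volume_affineSegment _ _

theorem dist_le_h (E : Element) {x y : Plane} (hx : x ∈ E.carrier) (hy : y ∈ E.carrier) :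
    dist x y ≤ E.h := Metric.dist_le_diam_of_mem E.isBounded hx hy

theorem h_pos (E : Element) : 0 < E.h := by
  obtain ⟨x, hx⟩ := E.isConnected.nonempty
  obtain ⟨r, hr, hb⟩ := Metric.isOpen_iff.1 E.isOpen x hx
  have hn : ‖(EuclideanSpace.single 0 (r / 2) : Plane)‖ = r / 2 := by
    simp [abs_of_pos hr]
  have hy : x + EuclideanSpace.single 0 (r / 2) ∈ E.carrier := hb (by
    rw [mem_ball_iff_norm, add_sub_cancel_left, hn]; linarith)
  have := E.dist_le_h hy hx
  rw [dist_eq_norm, add_sub_cancel_left, hn] at this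
  linarith

variable {E : Element} {κ : ℝ}

theorem IsRegular.starConvex (hE : E.IsRegular κ) :
    ∀ y ∈ Metric.ball E.center (κ * E.h), StarConvex ℝ y E.carrier := by
  obtain ⟨⟨ρ, h1, h2⟩, -⟩ := hE
  exact fun y hy => h2 y (Metric.ball_subset_ball h1 hy)

theorem IsRegular.ball_subset (hE : E.IsRegular κ) :
    Metric.ball E.center (κ * E.h) ⊆ E.carrier := fun y hy =>
  (hE.starConvex y hy).mem E.isConnected.nonempty

theorem IsRegular.center_mem (hE : E.IsRegular κ) (hκ : 0 < κ) : E.center ∈ E.carrier :=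
  hE.ball_subset (Metric.mem_ball_self (mul_pos hκ E.h_pos))

theorem IsRegular.subset_closedBall (hE : E.IsRegular κ) (hκ : 0 < κ) :
    E.carrier ⊆ Metric.closedBall E.center E.h := fun _ hx =>
  E.dist_le_h hx (hE.center_mem hκ)

end Element

namespace Mesh

variable {Ω : Set Plane} (M : Mesh Ω)

theorem h_elt_le (i : Fin M.N) : (M.elt i).h ≤ M.h :=
  le_ciSup (f := fun i => (M.elt i).h) (Finite.bddAbove_range _) i

/-- A point of `Ω` in no open element lies on the frontier of one, and frontiers are finite unions
of segments, hence null. -/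
theorem sum_integral {f : Plane → ℝ} (hf : IntegrableOn f Ω) :
    ∑ i, ∫ x in (M.elt i).carrier, f x = ∫ x in Ω, f x := by
  rw [← integral_iUnion_fintype (fun i => (M.elt i).isOpen.measurableSet)
    (fun i j hij => M.disjoint i j hij) fun i => hf.mono_set (M.subset i)]
  refine setIntegral_congr_set (((iUnion_subset M.subset).eventuallyLE).antisymm ?_)
  have h0 : volume (⋃ i, frontier (M.elt i).carrier) = 0 :=
    measure_iUnion_null fun i => (M.elt i).volume_frontier
  filter_upwards [measure_eq_zero_iff_ae_notMem.1 h0] with x hx hxΩ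
  obtain ⟨i, hi⟩ := mem_iUnion.1 (M.cover hxΩ)
  refine mem_iUnion.2 ⟨i, ?_⟩
  by_contra hxi
  refine hx (mem_iUnion.2 ⟨i, hi, ?_⟩)
  rwa [(M.elt i).isOpen.interior_eq]

end Mesh

theorem betaNorm_nonneg (β : Plane → Plane) (U : Set Plane) : 0 ≤ betaNorm β U := by
  refine Real.sSup_nonneg ?_
  rintro r ⟨v, -, -, rfl⟩
  exact div_nonneg lpNorm_nonneg lpNorm_nonneg

/-- The value `c = 0` is always admissible. Beyond its sign, the value of this constant plays no
role: it merely enters the final `C`. -/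
theorem inverseConst_nonneg (k : ℕ) (κ : ℝ) : 0 ≤ inverseConst k κ := by
  rw [inverseConst]
  by_cases h : BddAbove {c | ∀ E : Element, E.IsRegular κ → ∀ p : Poly, p.totalDegree ≤ k →
    c * E.h ^ 2 * lpNorm (polyFun (polyDiv (polyGrad p))) 2 (area E.carrier) ^ 2 ≤
      lpNorm (polyField (polyGrad p)) 2 (area E.carrier) ^ 2}
  · refine le_csSup h fun E _ p _ => ?_
    rw [zero_mul, zero_mul]
    positivity
  -- The supremum of a set unbounded above is 0 by convention.
  · rw [Real.sSup_of_not_bddAbove h]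

theorem mConst_nonneg (k : ℕ) (κ : ℝ) : 0 ≤ mConst k κ := by
  have := inverseConst_nonneg k κ
  rw [mConst]
  split_ifs <;> positivity

theorem tau_nonneg (k : ℕ) (κ : ℝ) {K : ℝ} (hK : 0 < K) (β : Plane → Plane) (E : Element) :
    0 ≤ tau k κ K β E := by
  have := betaNorm_nonneg β E.carrier
  have := mConst_nonneg k κ
  have := E.h_pos
  rw [tau, peclet]
  positivity

/-- Bounding the minimum by the Péclet number cancels `β_E`, leaving a quantity of order `h²`. -/
theorem tau_le (k : ℕ) (κ : ℝ) {K : ℝ} (hK : 0 < K) (β : Plane → Plane) (E : Element) :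
    tau k κ K β E ≤ mConst k κ * E.h ^ 2 / (2 * K) := by
  have hb := betaNorm_nonneg β E.carrier
  have hm := mConst_nonneg k κ
  have hh := E.h_pos
  rw [tau, peclet]
  rcases hb.eq_or_lt with h0 | h0
  -- If `β_E = 0`, division by zero makes `τ_E` equal to 0.
  · rw [← h0, mul_zero, div_zero, zero_mul]
    positivity
  · calc _ ≤ E.h / (2 * betaNorm β E.carrier) * (mConst k κ * (betaNorm β E.carrier * E.h / K)) := by
          gcongr; exact min_le_right _ _
      _ = _ := by field_simp

end Mesh

/-! ### Estimates of the three forms on one element. -/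

section LocalEstimates

variable {k : ℕ} {κ K : ℝ} {β : Plane → Plane} {E : Element} {ℓ : ℕ} {v : Plane → ℝ}
  {G : Plane → Plane} {φ : ℕ → Plane → ℝ}

theorem ApproxH1.isL2ProjField_projGrad (h : ApproxH1 E.carrier φ v G) (n : ℕ) :
    IsL2ProjField E.carrier n G (projGrad E n v) := by
  have h1 := (h.hasWeakGrad E.isBounded).weakGrad_ae_eq E.isOpen
  exact (isL2ProjField_l2ProjField E.isBounded n ((memLp_congr_ae h1).2 h.memLp_grad)).congr h1

theorem integral_normSq_smul_le {U : Set Plane} {u : Plane → ℝ} {r : Plane → Plane} {B : ℝ}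
    (hu : MemLp u 2 (area U)) (hr : ∀ᵐ x ∂(area U), ‖r x‖ ≤ B) :
    ∫ x in U, ‖u x • r x‖ ^ 2 ≤ B ^ 2 * ∫ x in U, ‖u x‖ ^ 2 := by
  rw [← integral_const_mul]
  refine integral_mono_of_nonneg (.of_forall fun x => sq_nonneg _)
    ((integrable_normSq hu).const_mul _) (hr.mono fun x hx => ?_)
  simp only [norm_smul, mul_pow]
  rw [mul_comm]
  gcongr

theorem integral_normSq_inner_le {U : Set Plane} {r w : Plane → Plane} {B : ℝ}
    (hw : MemLp w 2 (area U)) (hr : ∀ᵐ x ∂(area U), ‖r x‖ ≤ B) :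
    ∫ x in U, ‖inner ℝ (r x) (w x)‖ ^ 2 ≤ B ^ 2 * ∫ x in U, ‖w x‖ ^ 2 := by
  rw [← integral_const_mul]
  refine integral_mono_of_nonneg (.of_forall fun x => sq_nonneg _)
    ((integrable_normSq hw).const_mul _) (hr.mono fun x hx => ?_)
  simp only [← mul_pow]
  gcongr
  exact (norm_inner_le_norm _ _).trans (by gcongr)

theorem memLp_inner {U : Set Plane} {r w : Plane → Plane} {B : ℝ} (hw : MemLp w 2 (area U))
    (hr : AEStronglyMeasurable r (area U)) (hB : ∀ᵐ x ∂(area U), ‖r x‖ ≤ B) :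
    MemLp (fun x => inner ℝ (r x) (w x)) 2 (area U) := by
  refine hw.of_le_mul (c := B) (hr.inner hw.1) (hB.mono fun x hx => ?_)
  exact (norm_inner_le_norm _ _).trans (by gcongr)

theorem aForm_self (hK : 0 < K) :
    K * ∫ x in E.carrier, ‖polyField (projGrad E (k + ℓ - 1) v) x‖ ^ 2 ≤
      aForm k κ K β E ℓ v v := by
  have h1 : 0 ≤ tau k κ K β E *
      ∫ x in E.carrier, inner ℝ (β x) (polyField (projGrad E (k + ℓ - 1) v) x) *
        inner ℝ (β x) (polyField (projGrad E (k + ℓ - 1) v) x) :=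
    mul_nonneg (tau_nonneg k κ hK β E) (integral_nonneg fun x => mul_self_nonneg _)
  rw [aForm]
  simp_rw [inner_smul_left, real_inner_self_eq_norm_sq, integral_const_mul]
  simpa using h1

/-- The factor `h²` of `τ_E` outweighs the `h⁻¹` lost to the inverse inequality, and both
projections of the gradient are bounded by `G` in `L²`. -/
theorem abs_dForm_self_le (hK : 0 < K) {B C : ℝ}
    (hβm : AEStronglyMeasurable β (area E.carrier)) (hβ : ∀ᵐ x ∂(area E.carrier), ‖β x‖ ≤ B)
    (hC : 0 ≤ C) (hinv : ∀ P : Fin 2 → Poly, (∀ i, (P i).totalDegree ≤ k - 1) →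
      E.h ^ 2 * ∫ x in E.carrier, ‖polyFun (polyDiv P) x‖ ^ 2 ≤
        C * ∫ x in E.carrier, ‖polyField P x‖ ^ 2)
    (hv : ApproxH1 E.carrier φ v G) :
    |dForm k κ K β E ℓ v v| ≤
      mConst k κ / 4 * (C + B ^ 2) * E.h * ∫ x in E.carrier, ‖G x‖ ^ 2 := by
  have hP := hv.isL2ProjField_projGrad (k - 1)
  have hQ := hv.isL2ProjField_projGrad (k + ℓ - 1)
  rw [dForm]
  set P := projGrad E (k - 1) v
  set Q := projGrad E (k + ℓ - 1) v
  have bE := E.isBounded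
  have hh := E.h_pos
  have hm := mConst_nonneg k κ
  have mD := (memLp_of_continuous bE (continuous_polyFun (polyDiv P))).const_mul K
  have mQ := memLp_of_continuous bE (continuous_polyField Q)
  have mβQ := memLp_inner mQ hβm hβ
  have nP := hP.integral_normSq bE hv.memLp_grad
  have nQ := hQ.integral_normSq bE hv.memLp_grad
  have h0 : 0 ≤ ∫ x in E.carrier, ‖G x - polyField P x‖ ^ 2 := by positivity
  have h0' : 0 ≤ ∫ x in E.carrier, ‖G x - polyField Q x‖ ^ 2 := by positivity
  have h1 := hinv P fun i => (hP i).1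
  have h2 := integral_normSq_inner_le mQ hβ
  -- This weight turns the divergence term into `h² d`, the form the inverse inequality controls,
  -- with one factor `h` left over.
  have h3 := abs_integral_inner_le mD mβQ (s := E.h / K) (by positivity)
  simp only [RCLike.inner_apply, conj_trivial, norm_mul, mul_pow, integral_const_mul] at h3
  have hKn : ‖K‖ ^ 2 = K ^ 2 := by rw [Real.norm_eq_abs, sq_abs]
  rw [hKn] at h3
  set g := ∫ x in E.carrier, ‖G x‖ ^ 2
  set d := ∫ x in E.carrier, ‖polyFun (polyDiv P) x‖ ^ 2
  set q := ∫ x in E.carrier, ‖inner ℝ (β x) (polyField Q x)‖ ^ 2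
  have hd : E.h ^ 2 * d ≤ C * g := h1.trans (by gcongr; linarith)
  have hq : q ≤ B ^ 2 * g := h2.trans (by gcongr; linarith)
  have hτ := tau_le k κ hK β E
  rw [abs_neg, abs_mul, abs_of_nonneg (tau_nonneg k κ hK β E)]
  have e : ∀ x, K * polyFun (polyDiv P) x * inner ℝ (β x) (polyField Q x) =
    inner ℝ (β x) (polyField Q x) * (K * polyFun (polyDiv P) x) := fun x => mul_comm _ _
  simp_rw [e]
  calc _ ≤ mConst k κ * E.h ^ 2 / (2 * K) * ((E.h / K * (K ^ 2 * d) + (E.h / K)⁻¹ * q) / 2) := by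
        gcongr
    _ = mConst k κ / 4 * E.h * (E.h ^ 2 * d + q) := by field_simp; ring
    _ ≤ mConst k κ / 4 * E.h * (C * g + B ^ 2 * g) := by gcongr
    _ = _ := by ring

/-- The consistency error of the convective form on an element, where `β` is compared with a
Lipschitz field `g`. -/
theorem abs_bForm_self_sub_le {B C L N s : ℝ} (hs : 0 < s) (hκ : 0 < κ) (hE : E.IsRegular κ)
    (hβm : MemLp β ⊤ (area E.carrier)) (hβ : ∀ᵐ x ∂(area E.carrier), ‖β x‖ ≤ B)
    {g : Plane → Plane} (hgc : Continuous g) (hgN : ∀ x, ‖g x‖ ≤ N)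
    (hgL : ∀ x y, ‖g x - g y‖ ≤ L * dist x y) (hL : 0 ≤ L)
    (hv : ApproxH1 E.carrier φ v G)
    (hpoin : ∀ p, IsL2Proj E.carrier (k - 1) v p →
      ∫ x in E.carrier, ‖v x - polyFun p x‖ ^ 2 ≤ C * E.h ^ 2 * ∫ x in E.carrier, ‖G x‖ ^ 2) :
    |bForm k β E v v - ∫ x in E.carrier, inner ℝ (v x • β x) (G x)| ≤
      (B ^ 2 * C + N ^ 2 * C + 3) / 2 * E.h * (∫ x in E.carrier, ‖G x‖ ^ 2) +
      L ^ 2 / 2 * E.h * (∫ x in E.carrier, ‖v x‖ ^ 2) +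
      (s⁻¹ * (∫ x in E.carrier, ‖v x • (β x - g x)‖ ^ 2) +
        s * ∫ x in E.carrier, ‖G x‖ ^ 2) / 2 := by
  have bE := E.isBounded
  have := isFiniteMeasure_area bE
  have hh := E.h_pos
  have hP := hv.isL2ProjField_projGrad (k - 1)
  have hp := isL2Proj_l2Proj bE (k - 1) hv.memLp
  have h0 := hpoin _ hp
  rw [bForm]
  set P := projGrad E (k - 1) v
  set p := l2Proj E.carrier (k - 1) v
  have mP := memLp_of_continuous bE (continuous_polyField P)
  have mp := memLp_of_continuous bE (continuous_polyFun p)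
  have mD : MemLp (fun x => polyField P x - G x) 2 (area E.carrier) := mP.sub hv.memLp_grad
  have mg : MemLp g ⊤ (area E.carrier) :=
    memLp_top_of_bound hgc.aestronglyMeasurable N (.of_forall hgN)
  have mc : MemLp (fun _ : Plane => g E.center) ⊤ (area E.carrier) := memLp_const _
  have m1 := memLp_smul_of_bounded (mp.sub hv.memLp) hβm
  have m2 := memLp_smul_of_bounded hv.memLp (hβm.sub mg)
  have m3 := memLp_smul_of_bounded hv.memLp (mg.sub mc)
  have m4 := memLp_smul_of_bounded (hv.memLp.sub mp) mc
  have m5 := memLp_smul_of_bounded mp mc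
  simp only [Pi.sub_apply] at m1 m2 m3 m4
  have mβ := memLp_smul_of_bounded hv.memLp hβm
  have mpβ := memLp_smul_of_bounded mp hβm
  -- Freezing `g` at the centre makes `p g` a polynomial field of degree at most `k - 1`, orthogonal
  -- to the projection error of the gradient.
  have orth : ∫ x in E.carrier, inner ℝ (polyFun p x • g E.center) (polyField P x - G x) = 0 := by
    have e : ∀ x, inner ℝ (polyFun p x • g E.center) (polyField P x - G x) =
        -inner ℝ (G x - polyField P x)
          (polyField (fun i => MvPolynomial.C (g E.center i) * p) x) := fun x => by
      rw [← inner_neg_left, neg_sub, real_inner_comm]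
      congr 1
      ext i
      simp [polyField, polyFun, mul_comm]
    simp_rw [e]
    rw [integral_neg, hP.integral_inner_sub bE hv.memLp_grad fun i => ?_, neg_zero]
    refine (MvPolynomial.totalDegree_mul _ _).trans ?_
    rw [MvPolynomial.totalDegree_C, zero_add]
    exact hp.1
  have i1 := integrable_inner m1 mP
  have i2 := integrable_inner m2 mD
  have i3 := integrable_inner m3 mD
  have i4 := integrable_inner m4 mD
  have i5 := integrable_inner m5 mD
  -- Telescoping `v → p` and `β → g → g(center)`; the last piece of the sum is `orth`.
  have split : (∫ x in E.carrier, inner ℝ (β x) (polyField P x) * polyFun p x) -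
      ∫ x in E.carrier, inner ℝ (v x • β x) (G x) =
      (∫ x in E.carrier, inner ℝ ((polyFun p x - v x) • β x) (polyField P x)) +
      (∫ x in E.carrier, inner ℝ (v x • (β x - g x)) (polyField P x - G x)) +
      (∫ x in E.carrier, inner ℝ (v x • (g x - g E.center)) (polyField P x - G x)) +
      ∫ x in E.carrier, inner ℝ ((v x - polyFun p x) • g E.center) (polyField P x - G x) := by
    have e0 : ∀ x, inner ℝ (β x) (polyField P x) * polyFun p x =
        inner ℝ (polyFun p x • β x) (polyField P x) := fun x => by
      rw [real_inner_smul_left, mul_comm]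
    simp_rw [e0]
    rw [← integral_sub' (integrable_inner mpβ mP) (integrable_inner mβ hv.memLp_grad),
      ← integral_add' i1 i2, ← integral_add' (i1.add i2) i3,
      ← integral_add' ((i1.add i2).add i3) i4]
    refine Eq.trans ?_ (add_zero _)
    rw [← orth, ← integral_add' (((i1.add i2).add i3).add i4) i5]
    refine integral_congr_ae (.of_forall fun x => ?_)
    simp only [real_inner_smul_left, inner_sub_left, inner_sub_right, Pi.add_apply, Pi.sub_apply]
    ring
  have nG := hP.integral_normSq bE hv.memLp_grad
  have nD : ∫ x in E.carrier, ‖polyField P x - G x‖ ^ 2 =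
    ∫ x in E.carrier, ‖G x - polyField P x‖ ^ 2 := by simp_rw [norm_sub_rev]
  have np : ∫ x in E.carrier, ‖polyFun p x - v x‖ ^ 2 =
    ∫ x in E.carrier, ‖v x - polyFun p x‖ ^ 2 := by simp_rw [norm_sub_rev]
  have a1 := abs_integral_inner_le m1 mP (s := E.h⁻¹) (by positivity)
  -- The other three terms have a first factor of size `h`, whence their weight `h⁻¹`. This one has
  -- no power of `h` and keeps a fixed weight, to be absorbed by the energy.
  have a2 := abs_integral_inner_le m2 mD (s := s⁻¹) (by positivity)
  have a3 := abs_integral_inner_le m3 mD (s := E.h⁻¹) (by positivity)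
  have a4 := abs_integral_inner_le m4 mD (s := E.h⁻¹) (by positivity)
  have b1 := integral_normSq_smul_le (mp.sub hv.memLp) hβ
  have b3 := integral_normSq_smul_le (B := L * E.h) (r := fun x => g x - g E.center) hv.memLp (by
    filter_upwards [ae_restrict_mem E.isOpen.measurableSet] with x hx
    exact (hgL _ _).trans (by gcongr; exact E.dist_le_h hx (hE.center_mem hκ)))
  have b4 := integral_normSq_smul_le (B := N) (r := fun _ => g E.center) (hv.memLp.sub mp)
    (.of_forall fun _ => hgN _)
  simp only [Pi.sub_apply] at b1 b4
  have p0 : 0 ≤ ∫ x in E.carrier, ‖G x - polyField P x‖ ^ 2 := by positivity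
  have p1 : 0 ≤ ∫ x in E.carrier, ‖polyField P x‖ ^ 2 := by positivity
  rw [split]
  rw [nD] at a2 a3 a4
  rw [np] at b1
  rw [inv_inv] at a1 a2 a3 a4
  set γ := ∫ x in E.carrier, ‖G x‖ ^ 2
  set D := ∫ x in E.carrier, ‖G x - polyField P x‖ ^ 2
  set π := ∫ x in E.carrier, ‖polyField P x‖ ^ 2
  set w := ∫ x in E.carrier, ‖v x - polyFun p x‖ ^ 2
  have c1 := a1.trans (c := (E.h⁻¹ * (B ^ 2 * (C * E.h ^ 2 * γ)) + E.h * γ) / 2) (by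
    gcongr
    · exact b1.trans (by gcongr)
    · linarith)
  have c2 := a2.trans (c := (s⁻¹ * (∫ x in E.carrier, ‖v x • (β x - g x)‖ ^ 2) + s * γ) / 2) (by
    gcongr
    linarith)
  have c3 := a3.trans (c := (E.h⁻¹ * ((L * E.h) ^ 2 * ∫ x in E.carrier, ‖v x‖ ^ 2) + E.h * γ) / 2)
    (by gcongr; linarith)
  have c4 := a4.trans (c := (E.h⁻¹ * (N ^ 2 * (C * E.h ^ 2 * γ)) + E.h * γ) / 2) (by
    gcongr
    · exact b4.trans (by gcongr)
    · linarith)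
  refine (abs_add_le _ _).trans ((add_le_add ((abs_add_le _ _).trans (add_le_add
    ((abs_add_le _ _).trans (add_le_add c1 c2)) c3)) c4).trans_eq ?_)
  field_simp
  ring

end LocalEstimates

/-! ### Summation over the mesh and conclusion. -/

theorem ApproxH1.le_aForm_self {k : ℕ} {κ K α : ℝ} {β : Plane → Plane} {E : Element} {ℓ t : ℕ}
    {v : Plane → ℝ} {G : Plane → Plane} {φ : ℕ → Plane → ℝ} (hK : 0 < K)
    (h : ApproxH1 E.carrier φ v G) (hc : E.GradientCoercive k ℓ t α) (hv : E.MemLocalVEM k ℓ t v) :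
    α * K * ∫ x in E.carrier, ‖G x‖ ^ 2 ≤ aForm k κ K β E ℓ v v := by
  have h1 := (h.hasWeakGrad E.isBounded).weakGrad_ae_eq E.isOpen
  have h2 := hc v hv
  rw [lpNorm_two_sq ((memLp_congr_ae h1).2 h.memLp_grad),
    lpNorm_two_sq (memLp_of_continuous E.isBounded (continuous_polyField _)),
    integral_congr_ae (h1.mono fun x hx => by simp only [hx] :
      (fun x => ‖weakGrad E.carrier v x‖ ^ 2) =ᵐ[area E.carrier] fun x => ‖G x‖ ^ 2)] at h2
  refine le_trans ?_ (aForm_self hK)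
  calc _ = K * (α * ∫ x in E.carrier, ‖G x‖ ^ 2) := by ring
    _ ≤ _ := by gcongr; exact h2

theorem sq_energyNorm {Ω : Set Plane} (k : ℕ) (κ : ℝ) {K : ℝ} (hK : 0 < K) (β : Plane → Plane)
    (M : Mesh Ω) (ℓ : Fin M.N → ℕ) (v : Plane → ℝ) :
    energyNorm k κ K β M ℓ v ^ 2 = ∑ i, aForm k κ K β (M.elt i) (ℓ i) v v := by
  refine Real.sq_sqrt (Finset.sum_nonneg fun i _ => le_trans ?_ (aForm_self hK))
  positivity

/-- Smooth compactly supported fields are dense in `L⁴`. The constants `L` and `N` may blow up as `ε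
→ 0`, but no mesh enters their choice. -/
theorem exists_lipschitz_approx {Ω : Set Plane} (hΩ : Bornology.IsBounded Ω) {β : Plane → Plane}
    (hβ : MemLp β ⊤ (area Ω)) {ε : ℝ} (hε : 0 < ε) :
    ∃ g : Plane → Plane, ∃ L N : ℝ, Continuous g ∧ 0 ≤ L ∧ (∀ x, ‖g x‖ ≤ N) ∧
      (∀ x y, ‖g x - g y‖ ≤ L * dist x y) ∧
      eLpNorm (fun x => β x - g x) 4 (area Ω) ≤ ENNReal.ofReal ε := by
  have := isFiniteMeasure_area hΩ
  obtain ⟨g, h1, h2, h3⟩ := (hβ.mono_exponent le_top : MemLp β 4 (area Ω)).exist_eLpNorm_sub_le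
    (by norm_num) (by norm_num) hε
  obtain ⟨L, hL⟩ := h2.lipschitzWith_of_hasCompactSupport h1 (by simp)
  obtain ⟨N, hN⟩ := h2.continuous.bounded_above_of_compact_support h1
  exact ⟨g, L, N, h2.continuous, L.2, hN, fun x y => by
    rw [← dist_eq_norm]; exact hL.dist_le_mul x y, h3⟩

theorem exists_coercivity_const {Ω : Set Plane} (hΩb : Bornology.IsBounded Ω) {K : ℝ} (hK : 0 < K)
    {β : Plane → Plane} (hβ : MemLp β ⊤ (area Ω)) (hdiv : IsDivergenceFree Ω β) (k t : ℕ)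
    {κ : ℝ} (hκ : 0 < κ) {α : ℝ} (hα : 0 < α) :
    ∃ C : ℝ, 0 < C ∧ ∀ M : Mesh Ω, (∀ i, (M.elt i).IsRegular κ) →
      ∀ ℓ : Fin M.N → ℕ, (∀ i, (M.elt i).GradientCoercive k (ℓ i) t α) →
        ∀ v : Plane → ℝ, M.MemVEM k ℓ t v →
          (1 / 2 - C * M.h) * energyNorm k κ K β M ℓ v ^ 2 ≤
            ∑ i, supgForm k κ K β (M.elt i) (ℓ i) v v := by
  obtain ⟨CI, hCI, hinv⟩ := exists_inverse_ineq (k - 1) hκ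
  obtain ⟨CΩ, hCΩ, hpoin⟩ := exists_poincare_const hΩb
  obtain ⟨CS, hCS, hsob⟩ := exists_integral_sobolev_const hΩb
  -- The non-vanishing part of the convective error will be `(s + s)/2 · ‖G‖²`, which is half of the
  -- lower bound `α K ‖G‖²` for the energy.
  set s := α * K / 2 with hs
  have hs0 : 0 < s := by positivity
  -- With this accuracy `CS · ε ≤ s`; the `+ 1` guards against `CS = 0`.
  have hε : 0 < s / (CS + 1) := by positivity
  obtain ⟨g, L, N, hgc, hL, hgN, hgL, hg4⟩ := exists_lipschitz_approx hΩb hβ hε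
  set B := lpNorm β ⊤ (area Ω)
  have hB : ∀ᵐ x ∂(area Ω), ‖β x‖ ≤ B := ae_le_lpNorm_exponent_top hβ
  have hm := mConst_nonneg k κ
  set C₁ := mConst k κ / 4 * (CI + B ^ 2)
  set C₂ := (B ^ 2 * (4 / κ ^ 2) + N ^ 2 * (4 / κ ^ 2) + 3) / 2
  have hC₁ : 0 ≤ C₁ := by positivity
  have hC₂ : 0 ≤ C₂ := by positivity
  -- Dividing by `α K` converts `‖G‖²` into energy; the `+ 1` only ensures positivity.
  refine ⟨(C₁ + C₂ + L ^ 2 / 2 * CΩ) / (α * K) + 1, by positivity, fun M hM ℓ hℓ v hv => ?_⟩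
  obtain ⟨G, φ, hφ, ha⟩ := hv.1.exists_approx
  have hi : ∀ i, ApproxH1 (M.elt i).carrier φ v G := fun i => ha.mono (M.subset i)
  have hH : 0 ≤ M.h := Real.iSup_nonneg fun i => (M.elt i).h_pos.le
  have mmono : ∀ i, area (M.elt i).carrier ≤ area Ω := fun i =>
    Measure.restrict_mono (M.subset i) le_rfl
  have mr : MemLp (fun x => β x - g x) ⊤ (area Ω) :=
    hβ.sub (memLp_top_of_bound hgc.aestronglyMeasurable N (.of_forall hgN))
  set Γ := ∫ x in Ω, ‖G x‖ ^ 2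
  have hΓ : 0 ≤ Γ := by positivity
  have sumG : ∑ i, ∫ x in (M.elt i).carrier, ‖G x‖ ^ 2 = Γ :=
    M.sum_integral (integrable_normSq ha.memLp_grad)
  have sumv := M.sum_integral (integrable_normSq ha.memLp)
  have sumr := M.sum_integral (integrable_normSq (memLp_smul_of_bounded ha.memLp mr))
  have sumb := M.sum_integral (integrable_inner (memLp_smul_of_bounded ha.memLp hβ) ha.memLp_grad)
  -- The exact convective terms need not vanish element by element; only their sum does.
  rw [integral_inner_smul_eq_zero_of_divergenceFree hΩb hβ hdiv hφ ha] at sumb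
  have hv2 := hpoin φ v G hφ ha
  have hr2 : ∫ x in Ω, ‖v x • (β x - g x)‖ ^ 2 ≤ s ^ 2 * Γ := by
    refine (hsob φ v G hφ ha _ _ hε.le mr hg4).trans ?_
    gcongr
    rw [mul_div_assoc', div_le_iff₀ (by positivity)]
    nlinarith
  have hA : α * K * Γ ≤ ∑ i, aForm k κ K β (M.elt i) (ℓ i) v v := by
    rw [← sumG, Finset.mul_sum]
    exact Finset.sum_le_sum fun i _ => (hi i).le_aForm_self hK (hℓ i) (hv.2 i)
  have hd : -(C₁ * M.h * Γ) ≤ ∑ i, dForm k κ K β (M.elt i) (ℓ i) v v := by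
    rw [← sumG, Finset.mul_sum, ← Finset.sum_neg_distrib]
    refine Finset.sum_le_sum fun i _ => neg_le_of_abs_le ?_
    refine (abs_dForm_self_le hK (hβ.1.mono_measure (mmono i)) (ae_mono (mmono i) hB) hCI
      (hinv _ _ _ (M.elt i).h_pos (M.elt i).isOpen.measurableSet (hM i).ball_subset
        ((hM i).subset_closedBall hκ)) (hi i)).trans ?_
    gcongr
    exact M.h_elt_le i
  have hb : -(C₂ * M.h * Γ + L ^ 2 / 2 * M.h * (CΩ * Γ) + (s⁻¹ * (s ^ 2 * Γ) + s * Γ) / 2) ≤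
      ∑ i, bForm k β (M.elt i) v v := by
    have h1 : ∀ i, -(C₂ * M.h * (∫ x in (M.elt i).carrier, ‖G x‖ ^ 2) +
        L ^ 2 / 2 * M.h * (∫ x in (M.elt i).carrier, ‖v x‖ ^ 2) +
        (s⁻¹ * (∫ x in (M.elt i).carrier, ‖v x • (β x - g x)‖ ^ 2) +
          s * ∫ x in (M.elt i).carrier, ‖G x‖ ^ 2) / 2) ≤
        bForm k β (M.elt i) v v - ∫ x in (M.elt i).carrier, inner ℝ (v x • β x) (G x) := by
      intro i
      refine neg_le_of_abs_le ((abs_bForm_self_sub_le hs0 hκ (hM i) (hβ.mono_measure (mmono i))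
        (ae_mono (mmono i) hB) hgc hgN hgL hL (hi i) fun p hp => hp.poincare (M.elt i).isOpen
          (M.elt i).h_pos hκ (hM i).starConvex (hM i).ball_subset ((hM i).subset_closedBall hκ)
          (fun x hx y hy => (M.elt i).dist_le_h hx hy) (hi i)).trans ?_)
      have := M.h_elt_le i
      gcongr
    have h2 := Finset.sum_le_sum fun i (_ : i ∈ Finset.univ) => h1 i
    rw [Finset.sum_neg_distrib, Finset.sum_add_distrib, Finset.sum_add_distrib, ← Finset.mul_sum,
      ← Finset.mul_sum, ← Finset.sum_div, Finset.sum_add_distrib, ← Finset.mul_sum,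
      ← Finset.mul_sum, Finset.sum_sub_distrib, sumG, sumv, sumr, sumb, sub_zero] at h2
    refine le_trans (neg_le_neg ?_) h2
    gcongr
  rw [sq_energyNorm k κ hK]
  simp only [supgForm, Finset.sum_add_distrib]
  set A := ∑ i, aForm k κ K β (M.elt i) (ℓ i) v v
  have hαK : 0 < α * K := by positivity
  have hA0 : 0 ≤ A := le_trans (by positivity) hA
  have e1 : s⁻¹ * (s ^ 2 * Γ) = s * Γ := by field_simp
  have e2 : (C₁ + C₂ + L ^ 2 / 2 * CΩ) * M.h * Γ ≤
      (C₁ + C₂ + L ^ 2 / 2 * CΩ) / (α * K) * M.h * A := by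
    calc _ = (C₁ + C₂ + L ^ 2 / 2 * CΩ) / (α * K) * M.h * (α * K * Γ) := by field_simp
      _ ≤ _ := by gcongr
  have e3 : 0 ≤ M.h * A := by positivity
  rw [e1] at hb
  nlinarith

end SUPGVEM

theorem mainTheorem1
    (Ω : Set SUPGVEM.Plane) (hΩ : IsOpen Ω) (hΩb : Bornology.IsBounded Ω)
    (K : ℝ) (hK : 0 < K)
    (β : SUPGVEM.Plane → SUPGVEM.Plane) (hβ : MemLp β ⊤ (SUPGVEM.area Ω))
    (hdiv : SUPGVEM.IsDivergenceFree Ω β)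
    (k : ℕ) (hk : 1 ≤ k) (t : ℕ) (ht : t = k - 2 ∨ t = k - 1)
    (κ : ℝ) (hκ : 0 < κ) (α : ℝ) (hα : 0 < α) :
    (∃ C : ℝ, 0 < C ∧ ∀ M : SUPGVEM.Mesh Ω, (∀ i, (M.elt i).IsRegular κ) →
      ∀ ℓ : Fin M.N → ℕ, (∀ i, (M.elt i).GradientCoercive k (ℓ i) t α) →
        ∀ v : SUPGVEM.Plane → ℝ, M.MemVEM k ℓ t v →
          (1 / 2 - C * M.h) * SUPGVEM.energyNorm k κ K β M ℓ v ^ 2 ≤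
            ∑ i, SUPGVEM.supgForm k κ K β (M.elt i) (ℓ i) v v) ∧
    (∃ h₀ : ℝ, 0 < h₀ ∧ ∃ c : ℝ, 0 < c ∧ ∀ M : SUPGVEM.Mesh Ω,
      (∀ i, (M.elt i).IsRegular κ) → M.h ≤ h₀ →
      ∀ ℓ : Fin M.N → ℕ, (∀ i, (M.elt i).GradientCoercive k (ℓ i) t α) →
        ∀ v : SUPGVEM.Plane → ℝ, M.MemVEM k ℓ t v →
          c * SUPGVEM.energyNorm k κ K β M ℓ v ^ 2 ≤
            ∑ i, SUPGVEM.supgForm k κ K β (M.elt i) (ℓ i) v v) := by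
  obtain ⟨C, hC, h⟩ := SUPGVEM.exists_coercivity_const hΩb hK hβ hdiv k t hκ hα
  -- For `h ≤ 1/(4C)` the factor `1/2 - C h` is at least `1/4`.
  refine ⟨⟨C, hC, h⟩, 1 / (4 * C), by positivity, 1 / 4, by norm_num,
    fun M hM hh ℓ hℓ v hv => le_trans ?_ (h M hM ℓ hℓ v hv)⟩
  gcongr
  rw [le_div_iff₀ (by positivity)] at hh
  linarith
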